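/- **Notation.** Let $0\le m\le n$ be integers, let $\mathcal P^m$ be the space of real polynomials of degree at most $m$, with Bernstein basis $B^m_i(x)=\binom mi x^i(1-x)^{m-i}$, $0\le i\le m$, and let $\Pi(p)\in\mathbb R^{m+1}$ be the coefficient vector of $p\in\mathcal P^m$ in this basis. Let $E^{m,n}$ be the $(n+1)\times(m+1)$ degree elevation matrix, $E^{m,n}_{ij}=\binom mj\binom{n-m}{i-j}/\binom ni$, and let $\mathcal P^{m,n}=\{p\in\mathcal P^m: E^{m,n}\Pi(p)\ge 0\}$, the polynomials in $\mathcal P^m$ with nonnegative degree-$n$ Bernstein coefficients. Let $L^j$ be the Legendre polynomial on $[0,1]$ with $L^j(1)=1$, so that its degree-$j$ Bernstein coefficients are $\Pi(L^j)_i=(-1)^{j+i}\binom ji$. Let $U^{m,n}$ be the $(n+1)\times(m+1)$ matrix with columns $\sqrt{2j+1}\,E^{j,n}\Pi(L^j)$, $0\le j\le m$, and put $W^{m,n}=\tfrac12U^{m,n}(U^{m,n})^T$ and $\lambda^n_j=\frac{(n!)^2}{(n+j+1)!\,(n-j)!}$. All norms are $L^2(0,1)$ norms, and $\mathbf 1$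 denotes the all-ones vector. **Algorithm 1** (input $\Pi(p)$). Compute $e=E^{m,n}\Pi(p)$. Run through the subsets $J\subseteq\{0,\dots,n\}$ in any fixed order. For each $J$, if $A=(W^{m,n}_{ij})_{i,j\in J}$ has rank $|J|$, let $x=A^{-1}(-e_i)_{i\in J}$. If $x\ge0$, let $\mu$ equal $x$ on $J$ and $0$ off $J$, and let $y=W^{m,n}\mu+e$. If $y\ge0$, return $U^{m,m}\,\mathrm{diag}(\lambda^n_0,\dots,\lambda^n_m)\,(U^{m,n})^Ty$ and stop. **Algorithm 2** is the same with $A=(W^{m,n}_{ij}-\tfrac12)_{i,j\in J}$ and $y=W^{m,n}\mu-\tfrac{\nu}{2}\mathbf 1+e$, where $\nu=\sum_{i=0}^n\mu_i$. **Operation count.** Every scalar addition, subtraction, multiplication and division counts as one operation. Handling a $k\times k$ linear system (rank test and solution) is charged $2k^3/3$ operations, the usual leading-order count for Gaussian elimination, for every $J$ that is reached. The vector $e$ is computed once, and the product $W^{m,n}\mu$ uses only the entries $\mu_j$ with $j\in J$. Sign changes, comparisons, copying, and the entries of the fixed matrices $E^{m,n}$, $U^{m,n}$, $U^{m,m}$,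 $W^{m,n}$, $(W^{m,n}_{ij}-\frac12)_{ij}$ and of the $\lambda^n_j$ are free. **Theorem.** Let $p\in\mathcal P^m$, and fix any order of enumeration of the subsets of $\{0,\dots,n\}$. 1. There is a unique $q\in\mathcal P^{m,n}$ that minimizes $\|p-q\|_{L^2}$ over $\mathcal P^{m,n}$. Algorithm 1 returns exactly $\Pi(q)$, and it uses at most $$M(n+1)(2n+2m+3)+(n+1)(2m+1)+2(m+1)^2+\frac{2^{n-1}}{3}(n+1)^2(n+4)$$ operations, where $M$ is the number of sets $J$ reached for which $A$ has rank $|J|$ and $x\ge 0$. 2. Suppose $\int_0^1p(x)\,dx\ge0$. There is a unique $q\in\mathcal P^{m,n}$ with $\int_0^1q(x)\,dx=\int_0^1p(x)\,dx$ that minimizes $\|p-q\|_{L^2}$ among all such polynomials. Algorithm 2 returns exactly $\Pi(q)$, and it uses at most $$N\,[2(n+1)(n+m+2)+n]+(n+1)(2m+1)+2(m+1)^2+\frac{2^{n-1}}{3}(n+1)^2(n+4)$$ operations, where $N$ is the number of sets $J$ reached for which $A$ has rank $|J|$ and $x\ge0$. -/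

import Mathlib

open Polynomial

noncomputable section

namespace BernsteinKKT

/-! ### Polynomials of degree at most `m` and Bernstein coefficients -/

/-- The space `P^m` of real polynomials of degree at most `m`. -/
abbrev PolyLE (m : ℕ) : Submodule ℝ ℝ[X] := Polynomial.degreeLE ℝ (m : WithBot ℕ)

lemma bernsteinPolynomial_mem (m i : ℕ) : bernsteinPolynomial ℝ m i ∈ PolyLE m := by
  rw [Polynomial.mem_degreeLE]
  rcases le_or_gt i m with h | h
  · refine Polynomial.degree_le_of_natDegree_le ?_
    have h1 : ((m.choose i : ℝ[X]) * X ^ i * (1 - X) ^ (m - i)).natDegree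
        ≤ (0 + i) + (m - i) * 1 := by
      refine Polynomial.natDegree_mul_le_of_le
        (Polynomial.natDegree_mul_le_of_le (by simp) (by simp))
        (Polynomial.natDegree_pow_le_of_le _ ?_)
      exact (Polynomial.natDegree_sub_le _ _).trans (by simp)
    rw [bernsteinPolynomial]
    omega
  · simp [bernsteinPolynomial.eq_zero_of_lt ℝ h]

lemma finrank_polyLE (m : ℕ) : Module.finrank ℝ (PolyLE m) = m + 1 := by
  have h : PolyLE m = Polynomial.degreeLT ℝ (m + 1) := Polynomial.degreeLT_succ_eq_degreeLE.symm
  rw [h, (Polynomial.degreeLTEquiv ℝ (m + 1)).finrank_eq]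
  simp

lemma linearIndependent_bernsteinPolynomial (m : ℕ) :
    LinearIndependent ℝ (fun i : Fin (m + 1) => bernsteinPolynomial ℝ m i) := by
  rw [Fintype.linearIndependent_iff]
  intro g hg
  suffices h : ∀ k : ℕ, ∀ hk : k < m + 1, g ⟨k, hk⟩ = 0 from fun i => h i i.2
  intro k
  induction k using Nat.strong_induction_on with
  | _ k ih =>
    intro hk
    have hc := congrArg (fun f => Polynomial.coeff f k) hg
    simp only [Polynomial.finsetSum_coeff, Polynomial.coeff_smul, Polynomial.coeff_zero] at hc
    rw [Finset.sum_eq_single (⟨k, hk⟩ : Fin (m + 1))] at hc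
    · have h1 : (bernsteinPolynomial ℝ m k).coeff k = (m.choose k : ℝ) := by
        rw [bernsteinPolynomial, mul_assoc, Polynomial.coeff_natCast_mul,
          mul_comm (X ^ k : ℝ[X])]
        have h0 := Polynomial.coeff_mul_X_pow ((1 - X : ℝ[X]) ^ (m - k)) k 0
        rw [zero_add] at h0
        rw [h0]
        simp [Polynomial.coeff_zero_eq_eval_zero]
      have h2 : (m.choose k : ℝ) ≠ 0 := by
        exact_mod_cast (Nat.choose_pos (by omega)).ne'
      rw [h1, smul_eq_mul] at hc
      exact (mul_eq_zero.mp hc).resolve_right h2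
    · intro b _ hb
      rcases lt_or_gt_of_ne (fun h : (b : ℕ) = k => hb (Fin.ext h)) with h | h
      · rw [show g b = 0 from ih b h b.2, zero_smul]
      · have : (bernsteinPolynomial ℝ m b).coeff k = 0 := by
          rw [bernsteinPolynomial, mul_assoc, Polynomial.coeff_natCast_mul,
            mul_comm (X ^ (b : ℕ) : ℝ[X]), Polynomial.coeff_mul_X_pow', if_neg (by omega),
            mul_zero]
        rw [this, smul_zero]
    · intro h
      exact absurd (Finset.mem_univ _) h

/-- The basis `B^m_0, …, B^m_m` of `P^m`, with `B^m_i = C(m,i) x^i (1-x)^(m-i)`. -/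
def bernsteinBasis (m : ℕ) : Module.Basis (Fin (m + 1)) ℝ (PolyLE m) :=
  basisOfLinearIndependentOfCardEqFinrank
    (b := fun i : Fin (m + 1) =>
      (⟨bernsteinPolynomial ℝ m i, bernsteinPolynomial_mem m i⟩ : PolyLE m))
    (LinearIndependent.of_comp (PolyLE m).subtype (linearIndependent_bernsteinPolynomial m))
    (by rw [finrank_polyLE, Fintype.card_fin])

@[simp] lemma bernsteinBasis_apply (m : ℕ) (i : Fin (m + 1)) :
    (bernsteinBasis m i : ℝ[X]) = bernsteinPolynomial ℝ m i := by
  rw [bernsteinBasis, coe_basisOfLinearIndependentOfCardEqFinrank]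

/-- The vector `Π(p)` of coefficients of `p ∈ P^m` in the degree `m` Bernstein basis. -/
def bernsteinCoeff {m : ℕ} (p : PolyLE m) : Fin (m + 1) → ℝ := (bernsteinBasis m).equivFun p

/-! ### The matrices -/

/-- The degree elevation matrix `E^{m,n}`, of size `(n+1) × (m+1)`, with entries
`C(m,j) C(n-m,i-j) / C(n,i)`, where `C(n-m,i-j) = 0` for `i < j`. -/
def elevation (m n : ℕ) : Matrix (Fin (n + 1)) (Fin (m + 1)) ℝ := fun i j =>
  if (j : ℕ) ≤ i then
    (m.choose j : ℝ) * ((n - m).choose ((i : ℕ) - j) : ℝ) / (n.choose i : ℝ)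
  else 0

/-- The degree `j` Bernstein coefficients of the Legendre polynomial `L^j` on `[0,1]` with
`L^j(1) = 1`. -/
def legendreCoeff (j : ℕ) : Fin (j + 1) → ℝ := fun i => (-1) ^ (j + (i : ℕ)) * (j.choose i : ℝ)

/-- `U^{m,n}`, of size `(n+1) × (m+1)`; its `j`th column is `√(2j+1) E^{j,n} Π(L^j)`. -/
def matU (m n : ℕ) : Matrix (Fin (n + 1)) (Fin (m + 1)) ℝ := fun i j =>
  √(2 * (j : ℝ) + 1) * (elevation j n).mulVec (legendreCoeff j) i

/-- `W^{m,n} = (1/2) U^{m,n} (U^{m,n})ᵀ`. -/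
def matW (m n : ℕ) : Matrix (Fin (n + 1)) (Fin (n + 1)) ℝ :=
  (1 / 2 : ℝ) • (matU m n * (matU m n).transpose)

/-- The eigenvalues `λ^n_j = (n!)² / ((n+j+1)! (n-j)!)` of the degree `n` Bernstein mass matrix
(used for `j ≤ n`). -/
def massEigenvalue (n j : ℕ) : ℝ :=
  (n.factorial : ℝ) ^ 2 / ((n + j + 1).factorial * (n - j).factorial : ℝ)

/-! ### The optimization problems -/

/-- `P^{m,n}`: the polynomials in `P^m` whose degree `n` Bernstein coefficients are
nonnegative. -/
def posPoly (m n : ℕ) : Set (PolyLE m) := {p | 0 ≤ (elevation m n).mulVec (bernsteinCoeff p)}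

/-- The integral of a polynomial over `[0,1]`. -/
def mass (p : ℝ[X]) : ℝ := ∫ x in (0 : ℝ)..1, p.eval x

/-- The `L²(0,1)` norm of a polynomial. -/
def l2norm (p : ℝ[X]) : ℝ := √(∫ x in (0 : ℝ)..1, (p.eval x) ^ 2)

/-- `q` minimizes `‖p - q‖_{L²}` over `S`. -/
def IsBestApprox {m : ℕ} (S : Set (PolyLE m)) (p q : PolyLE m) : Prop :=
  q ∈ S ∧ ∀ r ∈ S, l2norm ((p : ℝ[X]) - q) ≤ l2norm ((p : ℝ[X]) - r)

/-! ### Programs with an operation count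

The scalar additions, subtractions, multiplications and divisions that a program carries out are
counted one by one. Solving a dense `k × k` system, including the test whether it is nonsingular,
is a primitive; the sizes of the systems handed to it are recorded and each is charged
`2k³/3` operations, whether or not the system turns out to be nonsingular. Comparisons, sign
changes, copying, and reading the entries of matrices that depend on `m` and `n` only are free. -/

/-- What a program records while it runs. -/
structure Tally where
  /-- number of scalar arithmetic operations -/
  flops : ℕ
  /-- sizes of the linear systems passed to the solver -/
  solves : List ℕ
  /-- number of nonsingular systems with a nonnegative solution -/
  nonnegSolutions : ℕ

/-- Programs that compute a value and update the tally. -/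
abbrev Counted (α : Type) : Type := StateM Tally α

/-- Run a program from the zero tally. -/
def Counted.exec {α : Type} (c : Counted α) : α × Tally := Id.run (StateT.run c ⟨0, [], 0⟩)

/-- The value a program computes. -/
def Counted.output {α : Type} (c : Counted α) : α := c.exec.1

/-- Total number of operations of a run: the scalar operations, plus `2k³/3` for each
`k × k` system passed to the solver. -/
def Counted.operations {α : Type} (c : Counted α) : ℝ :=
  (c.exec.2.flops : ℝ) + (c.exec.2.solves.map fun k => 2 * (k : ℝ) ^ 3 / 3).sum

/-- Number of nonsingular systems with a nonnegative solution met during a run. -/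
def Counted.nonnegSolutions {α : Type} (c : Counted α) : ℕ := c.exec.2.nonnegSolutions

/-- Record one scalar operation. -/
def tick : Counted Unit := modify fun t => { t with flops := t.flops + 1 }

def addOp (x y : ℝ) : Counted ℝ := do tick; return x + y

def subOp (x y : ℝ) : Counted ℝ := do tick; return x - y

def mulOp (x y : ℝ) : Counted ℝ := do tick; return x * y

def divOp (x y : ℝ) : Counted ℝ := do tick; return x / y

/-- Record that a nonnegative solution was found. -/
def recordNonneg : Counted Unit :=
  modify fun t => { t with nonnegSolutions := t.nonnegSolutions + 1 }

/-- Decide whether the square matrix `A` has full rank, and if so compute `A⁻¹ b`. -/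
def solve {κ : Type} [Fintype κ] [DecidableEq κ] (A : Matrix κ κ ℝ) (b : κ → ℝ) :
    Counted (Option (κ → ℝ)) := do
  modify fun t => { t with solves := Fintype.card κ :: t.solves }
  if A.rank = Fintype.card κ then return some (A⁻¹.mulVec b) else return none

/-- The sum of a list of numbers. -/
def sumList : List ℝ → Counted ℝ
  | [] => return 0
  | [a] => return a
  | a :: l => do
      let s ← sumList l
      addOp a s

/-- The sum of the products `a * b` over a list of pairs `(a, b)`. -/
def dot : List (ℝ × ℝ) → Counted ℝ
  | [] => return 0
  | [ab] => mulOp ab.1 ab.2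
  | ab :: l => do
      let s ← dot l
      let r ← mulOp ab.1 ab.2
      addOp r s

/-- Compute the entries of a vector one after the other. -/
def tabulate : (k : ℕ) → (Fin k → Counted ℝ) → Counted (Fin k → ℝ)
  | 0, _ => return Fin.elim0
  | k + 1, f => do
      let x ← f 0
      let v ← tabulate k fun i => f i.succ
      return Fin.cons x v

/-- The matrix-vector product `A v`. -/
def matVec {r c : ℕ} (A : Matrix (Fin r) (Fin c) ℝ) (v : Fin c → ℝ) : Counted (Fin r → ℝ) :=
  tabulate r fun i => dot (List.ofFn fun j => (A i j, v j))

/-- The matrix-vector product `A v` for a vector `v` that vanishes outside `J`; only the entries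
of `v` in `J` are used. -/
def matVecOn {r c : ℕ} (A : Matrix (Fin r) (Fin c) ℝ) (J : Finset (Fin c)) (v : Fin c → ℝ) :
    Counted (Fin r → ℝ) :=
  tabulate r fun i => dot (((List.finRange c).filter (· ∈ J)).map fun j => (A i j, v j))

/-- The vector indexed by `{0,…,n}` that equals `x` on `J` and `0` outside `J`. -/
def extendByZero {n : ℕ} (J : Finset (Fin (n + 1))) (x : J → ℝ) : Fin (n + 1) → ℝ :=
  fun i => if h : i ∈ J then x ⟨i, h⟩ else 0

/-- `q ← U^{m,m} diag(λ^n_0, …, λ^n_m) (U^{m,n})ᵀ y`. -/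
def reduceDegree (m n : ℕ) (y : Fin (n + 1) → ℝ) : Counted (Fin (m + 1) → ℝ) := do
  let z ← matVec (matU m n).transpose y
  let w ← tabulate (m + 1) fun j => mulOp (massEigenvalue n j) (z j)
  matVec (matU m m) w

/-! ### The two algorithms -/

open Classical in
/-- The body of the loop of the inequality-constrained algorithm for the active set `J`, with
`e = E^{m,n} Π(p)`. -/
def inequalityStep (m n : ℕ) (e : Fin (n + 1) → ℝ) (J : Finset (Fin (n + 1))) :
    Counted (Option (Fin (m + 1) → ℝ)) := do
  let A : Matrix J J ℝ := fun i j => matW m n i j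
  let b : J → ℝ := fun i => -e i
  match ← solve A b with
  | none => return none
  | some x =>
    if 0 ≤ x then
      recordNonneg
      let μ := extendByZero J x
      let Wμ ← matVecOn (matW m n) J μ
      let y ← tabulate (n + 1) fun i => addOp (Wμ i) (e i)
      if 0 ≤ y then
        let q ← reduceDegree m n y
        return some q
      else return none
    else return none

/-- The inequality-constrained algorithm. Its input is `c = Π(p)`; `Js` lists the subsets `J` of
`{0,…,n}` in the order in which the loop goes through them. The loop stops at the first `J` that
produces a result. -/
def inequalityAlgorithm (m n : ℕ) (Js : List (Finset (Fin (n + 1)))) (c : Fin (m + 1) → ℝ) :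
    Counted (Option (Fin (m + 1) → ℝ)) := do
  let e ← matVec (elevation m n) c
  Js.findSomeM? (inequalityStep m n e)

open Classical in
/-- The body of the loop of the algorithm with mass preservation for the active set `J`, with
`e = E^{m,n} Π(p)`. -/
def equalityStep (m n : ℕ) (e : Fin (n + 1) → ℝ) (J : Finset (Fin (n + 1))) :
    Counted (Option (Fin (m + 1) → ℝ)) := do
  let A : Matrix J J ℝ := fun i j => matW m n i j - 1 / 2
  let b : J → ℝ := fun i => -e i
  match ← solve A b with
  | none => return none
  | some x =>
    if 0 ≤ x then
      recordNonneg
      let μ := extendByZero J x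
      let ν ← sumList (List.ofFn μ)
      let Wμ ← matVecOn (matW m n) J μ
      let h ← divOp ν 2
      let y ← tabulate (n + 1) fun i => do
        let s ← subOp (Wμ i) h
        addOp s (e i)
      if 0 ≤ y then
        let q ← reduceDegree m n y
        return some q
      else return none
    else return none

/-- The algorithm with mass preservation; input and enumeration of the sets `J` are as in the
inequality-constrained algorithm. -/
def equalityAlgorithm (m n : ℕ) (Js : List (Finset (Fin (n + 1)))) (c : Fin (m + 1) → ℝ) :
    Counted (Option (Fin (m + 1) → ℝ)) := do
  let e ← matVec (elevation m n) c
  Js.findSomeM? (equalityStep m n e)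

end BernsteinKKT

end

open BernsteinKKT

noncomputable section

namespace BernsteinKKT

/-! ### Integrals of polynomials over `[0,1]` -/

/-! In orthonormal Legendre coordinates the `L²` norm is Euclidean (`l2norm_sub`) and the degree-`n`
Bernstein coefficients of `q` are `U^{m,n}` applied to its coordinates
(`elevation_mulVec_bernsteinCoeff`). With `z` the coordinates of `q - p`, the problem is to minimize
`|z|²` subject to `U z + e ≥ 0`.

The KKT conditions read `z = ½ Uᵀ μ`, `μ ≥ 0`, `y = W μ + e ≥ 0`, with `μ` and `y` complementary.
Some set `J` passes all tests (`exists_accepted`): the nearest point of the polyhedron to the origin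
is a conic combination of active normals, and Carathéodory's theorem makes the normals used linearly
independent, so the Gram block on `J` is nonsingular and the linear system returns their
multipliers. Conversely, every accepted `J` gives a KKT point, and `kkt_sufficient` leaves the
surplus `|w - z|²`, hence optimality and uniqueness. So the order of enumeration does not matter.

Recovering `Π(q)` from `y` needs `diag(λ) Uᵀ U = 1`. The Legendre operator acts on Bernstein
coefficients as a symmetric second-order difference operator. Both the moments of `L^j` against the
`B^n_i` and its degree-`n` coefficients solve the same eigenvalue recurrence, which one initial
value determines, so they are proportional with factor `λ^n_j` (`mass_bernstein_mul_legendrePoly`).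

The integral is the zeroth Legendre coordinate and the zeroth column of `U` is all ones. Preserving
mass deletes that column, which replaces `W` by `W - ½`.

For the cost, a nonsingular block has at most as many rows as `U` has columns, the final reduction
runs at most once, and the solver charges are at most the sum of `2|J|³/3` over all `J`. -/

lemma mass_add (p q : ℝ[X]) : mass (p + q) = mass p + mass q := by
  simp only [mass, eval_add]
  exact intervalIntegral.integral_add (p.continuous.intervalIntegrable _ _)
    (q.continuous.intervalIntegrable _ _)

lemma mass_C_mul (a : ℝ) (p : ℝ[X]) : mass (C a * p) = a * mass p := by
  simp [mass]

lemma mass_sub (p q : ℝ[X]) : mass (p - q) = mass p - mass q := by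
  have h := mass_add (p - q) q
  rw [sub_add_cancel] at h
  linarith

lemma mass_sum {ι : Type*} (s : Finset ι) (f : ι → ℝ[X]) :
    mass (∑ i ∈ s, f i) = ∑ i ∈ s, mass (f i) := by
  classical
  induction s using Finset.induction_on with
  | empty => simp [mass]
  | insert a s ha ih => rw [Finset.sum_insert ha, Finset.sum_insert ha, mass_add, ih]

lemma mass_derivative (p : ℝ[X]) : mass (derivative p) = p.eval 1 - p.eval 0 :=
  intervalIntegral.integral_eq_sub_of_hasDerivAt (fun x _ => p.hasDerivAt x)
    ((derivative p).continuous.intervalIntegrable _ _)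

/-- Interior Bernstein polynomials of degree `n + 1` vanish at both endpoints, so integrating their
derivatives shows that neighbouring degree-`n` masses agree; the index `0` supplies the common
value. -/
lemma mass_bernsteinPolynomial {n k : ℕ} (hk : k ≤ n) :
    mass (bernsteinPolynomial ℝ n k) = 1 / ((n : ℝ) + 1) := by
  have hn : (n : ℝ) + 1 ≠ 0 := by positivity
  induction k with
  | zero =>
    have h := mass_derivative (bernsteinPolynomial ℝ (n + 1) 0)
    have h2 : derivative (bernsteinPolynomial ℝ (n + 1) 0)
        = C (-((n : ℝ) + 1)) * bernsteinPolynomial ℝ n 0 := by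
      rw [bernsteinPolynomial.derivative_zero]; simp
    rw [h2, mass_C_mul, bernsteinPolynomial.eval_at_0, bernsteinPolynomial.eval_at_1] at h
    simp at h
    field_simp
    linarith
  | succ k ih =>
    have h := mass_derivative (bernsteinPolynomial ℝ (n + 1) (k + 1))
    have h2 : derivative (bernsteinPolynomial ℝ (n + 1) (k + 1))
        = C ((n : ℝ) + 1) * (bernsteinPolynomial ℝ n k - bernsteinPolynomial ℝ n (k + 1)) := by
      rw [bernsteinPolynomial.derivative_succ]; simp
    rw [h2, mass_C_mul, mass_sub, ih (by omega), bernsteinPolynomial.eval_at_0,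
      bernsteinPolynomial.eval_at_1, if_neg (by omega), if_neg (by omega), sub_zero] at h
    have := (mul_eq_zero.mp h).resolve_left hn
    linarith

/-! ### The Legendre operator -/

/-- The Legendre differential operator `p ↦ (x (1 - x) p')'`. -/
def legendreOp (p : ℝ[X]) : ℝ[X] := derivative (X * (1 - X) * derivative p)

lemma legendreOp_C_mul (a : ℝ) (p : ℝ[X]) : legendreOp (C a * p) = C a * legendreOp p := by
  rw [legendreOp, derivative_C_mul, mul_left_comm, derivative_C_mul, legendreOp]

lemma legendreOp_sum {ι : Type*} (s : Finset ι) (f : ι → ℝ[X]) :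
    legendreOp (∑ i ∈ s, f i) = ∑ i ∈ s, legendreOp (f i) := by
  simp only [legendreOp, derivative_sum, Finset.mul_sum]

/-- Lagrange's identity: the difference of the integrands is the derivative of `x(1-x)(p'q - pq')`,
which vanishes at both endpoints. -/
lemma mass_legendreOp_mul (p q : ℝ[X]) : mass (legendreOp p * q) = mass (p * legendreOp q) := by
  have h := mass_derivative (X * (1 - X) * (derivative p * q - p * derivative q))
  have h2 : derivative (X * (1 - X) * (derivative p * q - p * derivative q))
      = legendreOp p * q - p * legendreOp q := by
    simp only [legendreOp, derivative_mul, derivative_sub, derivative_X, derivative_one]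
    ring
  rw [h2, mass_sub] at h
  simp at h
  linarith

/-- The second-order difference operator with weights `F`. -/
def divDiff {R : Type*} [CommRing R] (F c : ℕ → R) (i : ℕ) : R :=
  F (i + 1) * (c (i + 1) - c i) - F i * (c i - c (i - 1))

/-- Discrete Lagrange identity, by telescoping. The ring is general because the sequences are
polynomials in `legendreOp_bernstein_sum` and real in `sum_legendreElev_mul_of_ne`. -/
lemma divDiff_green {R : Type*} [CommRing R] {F : ℕ → R} (hF : F 0 = 0) (b c : ℕ → R) (N : ℕ) :
    ∑ i ∈ Finset.range N, (c i * divDiff F b i - b i * divDiff F c i)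
      = F N * (c (N - 1) * b N - c N * b (N - 1)) := by
  induction N with
  | zero => simp [hF]
  | succ N ih =>
    rw [Finset.sum_range_succ, ih]
    simp only [divDiff, Nat.add_sub_cancel]
    ring

/-- The weights `i (n + 1 - i)` of the Legendre operator in Bernstein form. -/
def legendreWeight (n i : ℕ) : ℝ := (i : ℝ) * ((n : ℝ) + 1 - i)

lemma legendreWeight_zero (n : ℕ) : legendreWeight n 0 = 0 := by simp [legendreWeight]

lemma legendreWeight_last (n : ℕ) : legendreWeight n (n + 1) = 0 := by simp [legendreWeight]

/-- The truncated exponents `a - 1` and `b - 1` come with the factors `a²` and `b²`, so they are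
harmless at zero. -/
lemma legendreOp_monomial (a b : ℕ) :
    legendreOp (X ^ a * (1 - X) ^ b) =
      C ((a : ℝ) ^ 2) * (X ^ (a - 1) * (1 - X) ^ (b + 1))
        - C ((a : ℝ) * (b + 1) + b * (a + 1)) * (X ^ a * (1 - X) ^ b)
        + C ((b : ℝ) ^ 2) * (X ^ (a + 1) * (1 - X) ^ (b - 1)) := by
  have h : X * (1 - X) * derivative ((X : ℝ[X]) ^ a * (1 - X) ^ b)
      = C (a : ℝ) * (X ^ a * (1 - X) ^ (b + 1)) - C (b : ℝ) * (X ^ (a + 1) * (1 - X) ^ b) := by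
    rcases a with _ | a <;> rcases b with _ | b <;>
      simp [derivative_mul, derivative_pow] <;> ring
  rw [legendreOp, h]
  rcases a with _ | a <;> rcases b with _ | b <;>
      simp [derivative_mul, derivative_pow] <;> ring

lemma legendreOp_bernsteinPolynomial (n i : ℕ) :
    legendreOp (bernsteinPolynomial ℝ n i)
      = divDiff (fun i => C (legendreWeight n i)) (bernsteinPolynomial ℝ n) i := by
  have key : ∀ k, bernsteinPolynomial ℝ n k = C (n.choose k : ℝ) * (X ^ k * (1 - X) ^ (n - k)) :=
    fun k => by rw [bernsteinPolynomial]; simp [mul_assoc]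
  rcases lt_or_ge n i with hi | hi
  · have h1 : bernsteinPolynomial ℝ n i = 0 := bernsteinPolynomial.eq_zero_of_lt ℝ hi
    have h2 : bernsteinPolynomial ℝ n (i + 1) = 0 :=
      bernsteinPolynomial.eq_zero_of_lt ℝ (by omega)
    rw [divDiff, h1, h2]
    rcases Nat.lt_or_ge (n + 1) i with h | h
    · rw [bernsteinPolynomial.eq_zero_of_lt ℝ (show n < i - 1 by omega)]
      simp [legendreOp]
    · obtain rfl : i = n + 1 := by omega
      simp [legendreOp, legendreWeight_last]
  · obtain ⟨b, rfl⟩ := Nat.exists_eq_add_of_le hi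
    have hb : i + b - i = b := by omega
    have e1 : C ((i : ℝ) ^ 2) * C ((i + b).choose i : ℝ) * (X ^ (i - 1) * (1 - X) ^ (b + 1))
        = C (legendreWeight (i + b) i) * bernsteinPolynomial ℝ (i + b) (i - 1) := by
      rcases i with _ | i
      · simp [legendreWeight_zero]
      · rw [key, show i + 1 + b - (i + 1 - 1) = b + 1 by omega, ← C_mul, ← mul_assoc (C _) (C _), ← C_mul]
        congr 2
        have := Nat.choose_succ_right_eq (i + 1 + b) i
        rw [show i + 1 + b - i = b + 1 by omega] at this
        have h3 : ((i + 1 + b).choose (i + 1) : ℝ) * (i + 1) = ((i + 1 + b).choose i : ℝ) * (b + 1) :=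
          by exact_mod_cast this
        simp only [legendreWeight, Nat.add_sub_cancel]
        push_cast
        linear_combination ((i : ℝ) + 1) * h3
    have e2 : C ((b : ℝ) ^ 2) * C ((i + b).choose i : ℝ) * (X ^ (i + 1) * (1 - X) ^ (b - 1))
        = C (legendreWeight (i + b) (i + 1)) * bernsteinPolynomial ℝ (i + b) (i + 1) := by
      rcases b with _ | b
      · simp [legendreWeight]
      · rw [key, show i + (b + 1) - (i + 1) = b + 1 - 1 by omega, ← C_mul, ← mul_assoc (C _) (C _), ← C_mul]
        congr 2
        have := Nat.choose_succ_right_eq (i + (b + 1)) i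
        rw [show i + (b + 1) - i = b + 1 by omega] at this
        have h3 : ((i + (b + 1)).choose (i + 1) : ℝ) * (i + 1)
          = ((i + (b + 1)).choose i : ℝ) * (b + 1) := by exact_mod_cast this
        simp only [legendreWeight]
        push_cast
        linear_combination (-(b : ℝ) - 1) * h3
    rw [divDiff, mul_sub, mul_sub, ← e1, ← e2, key i, legendreOp_C_mul, hb, legendreOp_monomial]
    simp only [legendreWeight]
    push_cast
    simp only [C_add, C_sub, C_mul, C_pow]
    ring

lemma bernsteinPolynomial_sum_injective {n : ℕ} {a b : ℕ → ℝ}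
    (h : ∑ i ∈ Finset.range (n + 1), C (a i) * bernsteinPolynomial ℝ n i
      = ∑ i ∈ Finset.range (n + 1), C (b i) * bernsteinPolynomial ℝ n i) {i : ℕ} (hi : i ≤ n) :
    a i = b i := by
  have h1 := Fintype.linearIndependent_iff.mp (linearIndependent_bernsteinPolynomial n)
    (fun i => a i - b i) (by
      rw [Fin.sum_univ_eq_sum_range (fun i => (a i - b i) • bernsteinPolynomial ℝ n i) (n + 1)]
      simp only [smul_eq_C_mul, C_sub, sub_mul, Finset.sum_sub_distrib, h, sub_self])
    ⟨i, by omega⟩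
  exact sub_eq_zero.mp h1

/-- Summation by parts moves the difference operator from the basis to the coefficients; the
boundary terms vanish because the weights do at `0` and `n + 1`. -/
lemma legendreOp_bernstein_sum (n : ℕ) (c : ℕ → ℝ) :
    legendreOp (∑ i ∈ Finset.range (n + 1), C (c i) * bernsteinPolynomial ℝ n i)
      = ∑ i ∈ Finset.range (n + 1), C (divDiff (legendreWeight n) c i)
          * bernsteinPolynomial ℝ n i := by
  have h := divDiff_green (F := fun i => (C (legendreWeight n i) : ℝ[X]))
    (by simp [legendreWeight_zero]) (bernsteinPolynomial ℝ n) (fun i => C (c i)) (n + 1)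
  simp only [legendreWeight_last, C_0, zero_mul, Finset.sum_sub_distrib, sub_eq_zero] at h
  rw [legendreOp_sum]
  simp only [legendreOp_C_mul, legendreOp_bernsteinPolynomial]
  rw [h]
  refine Finset.sum_congr rfl fun i _ => ?_
  simp only [divDiff, C_sub, C_mul]
  ring

/-! ### Legendre polynomials -/

/-- The Legendre polynomial of degree `j` on `[0,1]`. -/
def legendrePoly (j : ℕ) : ℝ[X] :=
  ∑ i ∈ Finset.range (j + 1), C ((-1) ^ (j + i) * (j.choose i : ℝ)) * bernsteinPolynomial ℝ j i

lemma legendreOp_legendrePoly (j : ℕ) :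
    legendreOp (legendrePoly j) = C (-((j : ℝ) * (j + 1))) * legendrePoly j := by
  rw [legendrePoly, legendreOp_bernstein_sum, Finset.mul_sum]
  refine Finset.sum_congr rfl fun i hi => ?_
  rw [← mul_assoc, ← C_mul]
  congr 2
  obtain ⟨b, rfl⟩ := Nat.exists_eq_add_of_le (Finset.mem_range_succ_iff.mp hi)
  have h1 : ((i + b).choose (i + 1) : ℝ) * (i + 1) = ((i + b).choose i : ℝ) * b := by
    have := Nat.choose_succ_right_eq (i + b) i
    rw [show i + b - i = b by omega] at this
    exact_mod_cast this
  simp only [divDiff, legendreWeight]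
  rcases i with _ | i
  · simp only [zero_add] at h1 ⊢
    push_cast
    simp only [Nat.choose_zero_right, pow_add, CharP.cast_eq_zero, Nat.cast_one] at h1 ⊢
    linear_combination (-(b : ℝ) * (-1) ^ b) * h1
  · have h2 : ((i + 1 + b).choose (i + 1) : ℝ) * (i + 1) = ((i + 1 + b).choose i : ℝ) * (b + 1) := by
      have := Nat.choose_succ_right_eq (i + 1 + b) i
      rw [show i + 1 + b - i = b + 1 by omega] at this
      exact_mod_cast this
    simp only [Nat.add_sub_cancel, pow_add, pow_one]
    push_cast at h1 ⊢
    linear_combination (-b * ((-1) ^ i * (-1) * (-1) ^ b * ((-1) ^ i * (-1)))) * h1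
      + ((i + 1) * ((-1) ^ i * (-1) * (-1) ^ b * ((-1) ^ i * (-1)))) * h2

/-! ### Degree elevation and the recurrence for Legendre coefficients -/

lemma bernsteinPolynomial_elevation {k j n : ℕ} (hk : k ≤ j) (hj : j ≤ n) :
    bernsteinPolynomial ℝ j k = ∑ i ∈ Finset.range (n + 1),
      C (if k ≤ i then (j.choose k : ℝ) * ((n - j).choose (i - k) : ℝ) / (n.choose i : ℝ) else 0)
        * bernsteinPolynomial ℝ n i := by
  -- Multiply by `(x + (1 - x))^(n-j) = 1` and expand binomially. Only indices from `k` to `k + n -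
  -- j` occur, so the target sum is split into three ranges with vanishing outer parts.
  have e : bernsteinPolynomial ℝ j k
      = bernsteinPolynomial ℝ j k * (X + (1 - X)) ^ (n - j) := by simp
  rw [e, add_pow, Finset.mul_sum, show n + 1 = k + (n - j + 1) + (j - k) by omega,
    Finset.sum_range_add _ (k + (n - j + 1)) (j - k), Finset.sum_range_add _ k (n - j + 1)]
  have h1 : ∀ i ∈ Finset.range k,
      C (if k ≤ i then (j.choose k : ℝ) * ((n - j).choose (i - k) : ℝ) / (n.choose i : ℝ) else 0)
        * bernsteinPolynomial ℝ n i = 0 := fun i hi => by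
    rw [if_neg (by simpa using hi)]; simp
  have h2 : ∀ i ∈ Finset.range (j - k),
      C (if k ≤ k + (n - j + 1) + i then (j.choose k : ℝ) *
          ((n - j).choose (k + (n - j + 1) + i - k) : ℝ) / (n.choose (k + (n - j + 1) + i) : ℝ)
        else 0) * bernsteinPolynomial ℝ n (k + (n - j + 1) + i) = 0 := fun i hi => by
    rw [Nat.choose_eq_zero_of_lt (show n - j < k + (n - j + 1) + i - k by omega)]; simp
  rw [Finset.sum_eq_zero h1, Finset.sum_eq_zero h2, zero_add, add_zero]
  refine Finset.sum_congr rfl fun l hl => ?_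
  have hl' : l ≤ n - j := Finset.mem_range_succ_iff.mp hl
  rw [if_pos (by omega), Nat.add_sub_cancel_left, bernsteinPolynomial, bernsteinPolynomial,
    show n - (k + l) = (j - k) + (n - j - l) by omega, pow_add, pow_add]
  have hne : (n.choose (k + l) : ℝ) ≠ 0 := by
    exact_mod_cast (Nat.choose_pos (by omega)).ne'
  have h3 : (C ((j.choose k : ℝ) * ((n - j).choose l : ℝ) / (n.choose (k + l) : ℝ)) : ℝ[X])
      * (n.choose (k + l) : ℝ[X]) = (j.choose k : ℝ[X]) * ((n - j).choose l : ℝ[X]) := by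
    rw [← C_eq_natCast, ← C_eq_natCast, ← C_eq_natCast, ← C_mul, ← C_mul]
    rw [div_mul_cancel₀ _ hne]
  linear_combination (-(X ^ k * X ^ l * ((1 - X) ^ (j - k) * (1 - X) ^ (n - j - l)))) * h3

/-- The degree `n` Bernstein coefficients of the Legendre polynomial of degree `j`. -/
def legendreElev (j n i : ℕ) : ℝ :=
  ∑ k ∈ Finset.range (j + 1),
    (if k ≤ i then (j.choose k : ℝ) * ((n - j).choose (i - k) : ℝ) / (n.choose i : ℝ) else 0)
      * ((-1) ^ (j + k) * (j.choose k : ℝ))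

lemma legendrePoly_eq_sum {j n : ℕ} (hj : j ≤ n) :
    legendrePoly j
      = ∑ i ∈ Finset.range (n + 1), C (legendreElev j n i) * bernsteinPolynomial ℝ n i := by
  simp only [legendreElev, map_sum, Finset.sum_mul]
  rw [Finset.sum_comm, legendrePoly]
  refine Finset.sum_congr rfl fun k hk => ?_
  conv_lhs => rw [bernsteinPolynomial_elevation (Finset.mem_range_succ_iff.mp hk) hj]
  rw [Finset.mul_sum]
  refine Finset.sum_congr rfl fun i _ => ?_
  rw [C_mul (a := ite _ _ _)]
  ring

lemma legendreElev_self {j i : ℕ} (hi : i ≤ j) :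
    legendreElev j j i = (-1) ^ (j + i) * (j.choose i : ℝ) :=
  bernsteinPolynomial_sum_injective
    ((legendrePoly_eq_sum le_rfl).symm.trans (by rw [legendrePoly])) hi

lemma legendreElev_zero (j n : ℕ) : legendreElev j n 0 = (-1) ^ j := by
  rw [legendreElev, Finset.sum_range_succ']
  simp

lemma divDiff_legendreElev {j n i : ℕ} (hj : j ≤ n) (hi : i ≤ n) :
    divDiff (legendreWeight n) (legendreElev j n) i
      = -((j : ℝ) * (j + 1)) * legendreElev j n i := by
  refine bernsteinPolynomial_sum_injective (n := n) (a := divDiff _ _)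
    (b := fun i => -((j : ℝ) * (j + 1)) * legendreElev j n i) ?_ hi
  rw [← legendreOp_bernstein_sum, ← legendrePoly_eq_sum hj, legendreOp_legendrePoly,
    legendrePoly_eq_sum hj, Finset.mul_sum]
  simp only [C_mul, mul_assoc]

/-- The weight at `0` vanishes and the weights at `1, …, n` do not, so each equation determines the
next value from the previous ones and a single initial value suffices. -/
lemma eq_zero_of_divDiff_eq {n : ℕ} {s : ℝ} {h : ℕ → ℝ} (h0 : h 0 = 0)
    (hh : ∀ i ≤ n, divDiff (legendreWeight n) h i = s * h i) {i : ℕ} (hi : i ≤ n) : h i = 0 := by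
  induction i using Nat.strong_induction_on with
  | _ i ih =>
    rcases i with _ | i
    · exact h0
    · have h1 := hh i (by omega)
      rw [divDiff, ih i (by omega) (by omega), ih (i - 1) (by omega) (by omega)] at h1
      have h2 : legendreWeight n (i + 1) ≠ 0 := by
        have : (i : ℝ) + 1 ≤ n := by exact_mod_cast hi
        rw [legendreWeight]
        push_cast
        exact mul_ne_zero (by positivity) (by linarith)
      simpa [h2] using h1

/-! ### Eigenvalues of the Bernstein mass matrix -/

/-- After reversing the order of summation this is the `j`th forward difference of `x ↦ C(x,j)` at
`x = j`, which is `C(j,0)`. -/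
lemma sum_alternating_choose (j : ℕ) :
    ∑ k ∈ Finset.range (j + 1), ((-1 : ℤ) ^ k * j.choose k) * ((2 * j - k).choose j : ℤ) = 1 := by
  have h := fwdDiff_iter_eq_sum_shift (1 : ℕ) (fun x => (x.choose j : ℤ)) j j
  have h2 := congrFun (fwdDiff_iter_choose 0 j) j
  simp only [add_zero] at h2
  rw [h2] at h
  rw [← Finset.sum_range_reflect]
  simp only [Nat.choose_zero_right, Nat.cast_one, smul_eq_mul, mul_one] at h
  refine Eq.trans (Finset.sum_congr rfl fun k hk => ?_) h.symm
  have hk' := Finset.mem_range_succ_iff.mp hk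
  rw [show j + 1 - 1 - k = j - k by omega, Nat.choose_symm hk',
    show 2 * j - (j - k) = j + k by omega]

lemma massEigenvalue_self (j : ℕ) :
    massEigenvalue j j = 1 / ((2 * (j : ℝ) + 1) * ((2 * j).choose j : ℝ)) := by
  have h : (((2 * j).choose j * j.factorial * j.factorial : ℕ) : ℝ) = ((2 * j).factorial : ℕ) := by
    have := Nat.choose_mul_factorial_mul_factorial (show j ≤ 2 * j by omega)
    rw [show 2 * j - j = j by omega] at this
    exact_mod_cast this
  have h1 : ((2 * j).choose j : ℝ) ≠ 0 := by exact_mod_cast (Nat.choose_pos (by omega)).ne'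
  have h2 : ((2 * j).factorial : ℝ) ≠ 0 := by positivity
  rw [massEigenvalue, show j + j + 1 = 2 * j + 1 by ring, Nat.factorial_succ]
  push_cast at h ⊢
  simp only [Nat.sub_self, Nat.factorial_zero, Nat.cast_one, mul_one]
  rw [← h]
  have h3 : (j.factorial : ℝ) ≠ 0 := by positivity
  field_simp

lemma massEigenvalue_succ {j n : ℕ} (hj : j ≤ n) :
    massEigenvalue (n + 1) j * (((n : ℝ) + 1 - j) * (n + j + 2))
      = ((n : ℝ) + 1) ^ 2 * massEigenvalue n j := by
  obtain ⟨d, rfl⟩ := Nat.exists_eq_add_of_le hj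
  rw [massEigenvalue, massEigenvalue, show j + d + 1 - j = d + 1 by omega,
    show j + d - j = d by omega, show j + d + 1 + j + 1 = (j + d + j + 1) + 1 by ring,
    Nat.factorial_succ (j + d + j + 1), Nat.factorial_succ d, Nat.factorial_succ (j + d)]
  have h1 : ((j + d + j + 1).factorial : ℝ) ≠ 0 := by positivity
  have h2 : (d.factorial : ℝ) ≠ 0 := by positivity
  push_cast
  field_simp
  ring

/-- Initial value of the recurrence, by induction on `n`. For `n = j`, each `B^j_0 B^j_k` is a
multiple of `B^{2j}_k`, which leaves `sum_alternating_choose`. The step uses self-adjointness on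
`B^{n+1}_0` and `L^j`. -/
lemma mass_bernstein_zero_mul_legendrePoly {j n : ℕ} (hj : j ≤ n) :
    mass (bernsteinPolynomial ℝ n 0 * legendrePoly j) = (-1) ^ j * massEigenvalue n j := by
  induction n, hj using Nat.le_induction with
  | base =>
    have key : ∀ k ∈ Finset.range (j + 1),
        mass (bernsteinPolynomial ℝ j 0 *
          (C ((-1) ^ (j + k) * (j.choose k : ℝ)) * bernsteinPolynomial ℝ j k))
        = (-1) ^ j * massEigenvalue j j *
          (((-1) ^ k * (j.choose k : ℝ)) * ((2 * j - k).choose j : ℝ)) := fun k hk => by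
      have hk' := Finset.mem_range_succ_iff.mp hk
      have hne : ((2 * j).choose k : ℝ) ≠ 0 := by
        exact_mod_cast (Nat.choose_pos (by omega)).ne'
      have hne2 : ((2 * j).choose j : ℝ) ≠ 0 := by
        exact_mod_cast (Nat.choose_pos (by omega)).ne'
      have e : bernsteinPolynomial ℝ j 0 *
          (C ((-1) ^ (j + k) * (j.choose k : ℝ)) * bernsteinPolynomial ℝ j k)
          = C ((-1) ^ (j + k) * (j.choose k : ℝ) * ((j.choose k : ℝ) / ((2 * j).choose k : ℝ)))
            * bernsteinPolynomial ℝ (2 * j) k := by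
        have h3 : (C ((j.choose k : ℝ) / ((2 * j).choose k : ℝ)) : ℝ[X])
            * ((2 * j).choose k : ℝ[X]) = (j.choose k : ℝ[X]) := by
          rw [← C_eq_natCast, ← C_eq_natCast, ← C_mul, div_mul_cancel₀ _ hne]
        rw [C_mul (b := _ / _), bernsteinPolynomial, bernsteinPolynomial, bernsteinPolynomial,
          show 2 * j - k = j + (j - k) by omega, pow_add (1 - X : ℝ[X])]
        simp only [Nat.choose_zero_right, Nat.cast_one, pow_zero, mul_one, one_mul, Nat.sub_zero]
        linear_combination (-(C ((-1) ^ (j + k) * (j.choose k : ℝ)) * X ^ k *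
          ((1 - X) ^ j * (1 - X) ^ (j - k)))) * h3
      have h4 : ((2 * j).choose j : ℝ) * j.choose k = (2 * j).choose k * (2 * j - k).choose j := by
        have := Nat.choose_mul (n := 2 * j) hk'
        rw [← Nat.choose_symm (show j - k ≤ 2 * j - k by omega),
          show 2 * j - k - (j - k) = j by omega] at this
        exact_mod_cast this
      rw [e, mass_C_mul, mass_bernsteinPolynomial (by omega), massEigenvalue_self, pow_add]
      push_cast
      have h5 : (2 * (j : ℝ) + 1) ≠ 0 := by positivity
      field_simp
      linear_combination ((j.choose k : ℝ)) * h4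
    rw [legendrePoly, Finset.mul_sum, mass_sum, Finset.sum_congr rfl key, ← Finset.mul_sum]
    have := congrArg (Int.cast : ℤ → ℝ) (sum_alternating_choose j)
    push_cast at this
    rw [this, mul_one]
  | succ n hj ih =>
    have h := mass_legendreOp_mul (bernsteinPolynomial ℝ (n + 1) 0) (legendrePoly j)
    rw [legendreOp_bernsteinPolynomial, legendreOp_legendrePoly] at h
    -- Uses `B^{n+1}_1 = (n+1)(B^n_0 - B^{n+1}_0)`, which brings in the degree-`n` moment.
    have e1 : divDiff (fun i => C (legendreWeight (n + 1) i)) (bernsteinPolynomial ℝ (n + 1)) 0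
          * legendrePoly j
        = C (((n : ℝ) + 1) * (n + 1)) * (bernsteinPolynomial ℝ n 0 * legendrePoly j)
          - C (((n : ℝ) + 1) * (n + 1 + 1)) * (bernsteinPolynomial ℝ (n + 1) 0 * legendrePoly j) := by
      simp [divDiff, legendreWeight, bernsteinPolynomial]
      ring
    have e2 : bernsteinPolynomial ℝ (n + 1) 0 * (C (-((j : ℝ) * (j + 1))) * legendrePoly j)
        = C (-((j : ℝ) * (j + 1))) * (bernsteinPolynomial ℝ (n + 1) 0 * legendrePoly j) := by ring
    rw [e1, e2, mass_sub, mass_C_mul, mass_C_mul, mass_C_mul, ih] at h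
    have h3 := massEigenvalue_succ hj
    have h4 : (j : ℝ) ≤ n := by exact_mod_cast hj
    have h5 : ((n : ℝ) + 1 - j) * (n + j + 2) ≠ 0 :=
      mul_ne_zero (by linarith) (by positivity)
    apply mul_right_cancel₀ h5
    linear_combination -h - (-1) ^ j * h3

/-- As functions of `i` both sides satisfy the same recurrence, the left by self-adjointness and the
right by `divDiff_legendreElev`, and they agree at `i = 0`. -/
lemma mass_bernstein_mul_legendrePoly {j n i : ℕ} (hj : j ≤ n) (hi : i ≤ n) :
    mass (bernsteinPolynomial ℝ n i * legendrePoly j)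
      = massEigenvalue n j * legendreElev j n i := by
  refine sub_eq_zero.mp (eq_zero_of_divDiff_eq (n := n) (s := -((j : ℝ) * (j + 1)))
    (h := fun i => mass (bernsteinPolynomial ℝ n i * legendrePoly j)
      - massEigenvalue n j * legendreElev j n i) ?_ ?_ hi)
  · rw [mass_bernstein_zero_mul_legendrePoly hj, legendreElev_zero]
    ring
  · intro i hi
    have h := mass_legendreOp_mul (bernsteinPolynomial ℝ n i) (legendrePoly j)
    rw [legendreOp_bernsteinPolynomial, legendreOp_legendrePoly] at h
    have h2 := divDiff_legendreElev hj hi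
    simp only [divDiff, sub_mul, mul_assoc, mass_sub, mass_C_mul] at h h2 ⊢
    rw [mul_left_comm, mass_C_mul] at h
    linear_combination h - massEigenvalue n j * h2

/-- Eigenvectors of the symmetric difference operator for the distinct eigenvalues `-j(j+1)` and
`-k(k+1)`. -/
lemma sum_legendreElev_mul_of_ne {j k n : ℕ} (hj : j ≤ n) (hk : k ≤ n) (hjk : j ≠ k) :
    ∑ i ∈ Finset.range (n + 1), legendreElev j n i * legendreElev k n i = 0 := by
  have h := divDiff_green (legendreWeight_zero n) (legendreElev j n) (legendreElev k n) (n + 1)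
  rw [legendreWeight_last, zero_mul] at h
  have h2 : ((k : ℝ) * (k + 1) - j * (j + 1)) * ∑ i ∈ Finset.range (n + 1),
      legendreElev j n i * legendreElev k n i = 0 := by
    rw [← h, Finset.mul_sum]
    refine Finset.sum_congr rfl fun i hi => ?_
    have hi' := Finset.mem_range_succ_iff.mp hi
    rw [divDiff_legendreElev hj hi', divDiff_legendreElev hk hi']
    ring
  refine (mul_eq_zero.mp h2).resolve_left fun h3 => hjk ?_
  have h4 : ((k : ℝ) - j) * (k + j + 1) = 0 := by linear_combination h3
  have h5 : (k : ℝ) + j + 1 ≠ 0 := by positivity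
  have h6 := (mul_eq_zero.mp h4).resolve_right h5
  exact_mod_cast (sub_eq_zero.mp h6).symm

lemma mass_legendrePoly_mul {j k n : ℕ} (hj : j ≤ n) (hk : k ≤ n) :
    mass (legendrePoly j * legendrePoly k) = massEigenvalue n j *
      ∑ i ∈ Finset.range (n + 1), legendreElev j n i * legendreElev k n i := by
  rw [mul_comm, legendrePoly_eq_sum hk, Finset.sum_mul, mass_sum, Finset.mul_sum]
  refine Finset.sum_congr rfl fun i hi => ?_
  rw [mul_assoc, mass_C_mul, mass_bernstein_mul_legendrePoly hj (Finset.mem_range_succ_iff.mp hi)]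
  ring

/-- On the diagonal take `n = j`: the coefficients are signed binomials, and their squares sum to
`C(2j,j)`, which cancels against `λ^j_j`. -/
lemma mass_legendrePoly_mul_eq (j k : ℕ) :
    mass (legendrePoly j * legendrePoly k) = if j = k then 1 / (2 * (j : ℝ) + 1) else 0 := by
  split_ifs with h
  · subst h
    have h1 : ((2 * j).choose j : ℝ) ≠ 0 := by exact_mod_cast (Nat.choose_pos (by omega)).ne'
    have h2 : ∑ i ∈ Finset.range (j + 1), legendreElev j j i * legendreElev j j i
        = ((2 * j).choose j : ℝ) := by
      rw [← Nat.sum_range_choose_sq]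
      push_cast
      refine Finset.sum_congr rfl fun i hi => ?_
      rw [legendreElev_self (Finset.mem_range_succ_iff.mp hi)]
      have : ((-1 : ℝ) ^ (j + i)) ^ 2 = 1 := by rw [← pow_mul, mul_comm, pow_mul]; simp
      linear_combination (j.choose i : ℝ) ^ 2 * this
    rw [mass_legendrePoly_mul le_rfl le_rfl, h2, massEigenvalue_self]
    field_simp
  · rw [mass_legendrePoly_mul (le_max_left j k) (le_max_right j k),
      sum_legendreElev_mul_of_ne (le_max_left j k) (le_max_right j k) h, mul_zero]

/-- The integral of `L^j L^k` does not involve `n`, so its value carries over to coefficients of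
every admissible degree. -/
lemma sum_legendreElev_mul {j k n : ℕ} (hj : j ≤ n) (hk : k ≤ n) :
    massEigenvalue n j * ∑ i ∈ Finset.range (n + 1), legendreElev j n i * legendreElev k n i
      = if j = k then 1 / (2 * (j : ℝ) + 1) else 0 := by
  rw [← mass_legendrePoly_mul hj hk, mass_legendrePoly_mul_eq]

/-! ### Finitely generated cones -/

open scoped RealInnerProductSpace

/-- Carathéodory's theorem for cones. -/
lemma exists_linearIndependent_conic {ι E : Type*} [DecidableEq ι] [Fintype ι] [AddCommGroup E]
    [Module ℝ E] (u : ι → E) (A : Finset ι) (μ : ι → ℝ) (hμ : 0 ≤ μ) (hA : ∀ i ∉ A, μ i = 0) :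
    ∃ J ⊆ A, ∃ ν : ι → ℝ, 0 ≤ ν ∧ (∀ i ∉ J, ν i = 0) ∧ ∑ i, ν i • u i = ∑ i, μ i • u i ∧
      LinearIndependent ℝ (fun i : J => u i) := by
  induction A using Finset.strongInduction generalizing μ with
  | H A ih =>
    by_cases hli : LinearIndependent ℝ (fun i : A => u i)
    · exact ⟨A, subset_rfl, μ, hμ, hA, rfl, hli⟩
    obtain ⟨g, hg, i₁, hi₁⟩ : ∃ g : A → ℝ, ∑ i, g i • u i = 0 ∧ ∃ i, 0 < g i := by
      obtain ⟨g, hg, i, hi⟩ := Fintype.not_linearIndependent_iff.mp hli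
      rcases lt_or_gt_of_ne hi with h | h
      · exact ⟨-g, by simpa using hg, i, by simpa using h⟩
      · exact ⟨g, hg, i, h⟩
    -- Ratio test: the least `μ i / g i` over `g i > 0` is the largest multiple of the relation `g`
    -- that can be subtracted while staying nonnegative, and it annihilates the coefficient at `i₀`.
    obtain ⟨i₀, hi₀, hmin⟩ := Finset.exists_min_image (Finset.univ.filter fun i => 0 < g i)
      (fun i => μ i / g i) ⟨i₁, by simpa using hi₁⟩
    simp only [Finset.mem_filter, Finset.mem_univ, true_and] at hi₀ hmin
    let g' : ι → ℝ := fun i => if h : i ∈ A then g ⟨i, h⟩ else 0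
    have hg' : ∑ i, g' i • u i = 0 := by
      rw [← hg, ← Finset.sum_subset (Finset.subset_univ A) (fun i _ hi => by simp [g', hi]),
        ← Finset.sum_coe_sort A]
      exact Finset.sum_congr rfl fun i _ => by simp [g']
    let t : ℝ := μ i₀ / g i₀
    have ht : 0 ≤ t := div_nonneg (hμ _) hi₀.le
    have hν : 0 ≤ μ - t • g' := fun i => by
      simp only [Pi.zero_apply, Pi.sub_apply, Pi.smul_apply, smul_eq_mul, sub_nonneg]
      by_cases hi : i ∈ A
      · rw [show g' i = g ⟨i, hi⟩ by simp [g', hi]]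
        rcases lt_or_ge 0 (g ⟨i, hi⟩) with h | h
        · exact (le_div_iff₀ h).mp (hmin ⟨i, hi⟩ h)
        · exact (mul_nonpos_of_nonneg_of_nonpos ht h).trans (hμ i)
      · simpa [g', hi] using hμ i
    obtain ⟨J, hJ, ν, h1, h2, h3, h4⟩ := ih (A.erase i₀) (Finset.erase_ssubset i₀.2)
      (μ - t • g') hν (fun i hi => by
        by_cases hiA : i ∈ A
        · obtain rfl : i = i₀ := by
            by_contra hne
            exact hi (Finset.mem_erase.mpr ⟨hne, hiA⟩)
          simp [g', t, div_mul_cancel₀ _ hi₀.ne']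
        · simp [g', hA i hiA, hiA])
    refine ⟨J, hJ.trans (Finset.erase_subset _ _), ν, h1, h2, h3.trans ?_, h4⟩
    simp only [Pi.sub_apply, Pi.smul_apply, smul_eq_mul, sub_smul, Finset.sum_sub_distrib,
      mul_smul, ← Finset.smul_sum, hg', smul_zero, sub_zero]

/-- The cone generated by the vectors `u i` with `i ∈ A`. -/
def genCone {ι E : Type*} [Fintype ι] [AddCommGroup E] [Module ℝ E] (u : ι → E) (A : Finset ι) :
    Set E := {x | ∃ μ : ι → ℝ, 0 ≤ μ ∧ (∀ i ∉ A, μ i = 0) ∧ ∑ i, μ i • u i = x}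

/-- By Carathéodory the cone is a finite union of images of orthants under injective linear maps,
which are closed embeddings in finite dimension. -/
lemma isClosed_genCone {ι E : Type*} [Fintype ι] [NormedAddCommGroup E] [InnerProductSpace ℝ E]
    [FiniteDimensional ℝ E] (u : ι → E) (A : Finset ι) : IsClosed (genCone u A) := by
  classical
  have h : genCone u A = ⋃ J ∈ A.powerset.filter fun J : Finset ι => LinearIndependent ℝ (fun i : J => u i),
      Fintype.linearCombination ℝ (fun i : J => u i) '' {x | 0 ≤ x} := by
    ext x
    simp only [Set.mem_iUnion, Finset.mem_filter, Finset.mem_powerset, Set.mem_image,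
      Set.mem_ofPred_eq, exists_prop, genCone]
    constructor
    · rintro ⟨μ, hμ, hA, rfl⟩
      obtain ⟨J, hJ, ν, h1, h2, h3, h4⟩ := exists_linearIndependent_conic u A μ hμ hA
      refine ⟨J, ⟨hJ, h4⟩, fun i => ν i, fun i => h1 i, ?_⟩
      rw [← h3, Fintype.linearCombination_apply, Finset.sum_coe_sort J fun i => ν i • u i]
      exact Finset.sum_subset (Finset.subset_univ J) fun i _ hi => by simp [h2 i hi]
    · rintro ⟨J, ⟨hJ, -⟩, y, hy, rfl⟩
      refine ⟨fun i => if h : i ∈ J then y ⟨i, h⟩ else 0, fun i => ?_, fun i hi => ?_, ?_⟩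
      · by_cases h : i ∈ J
        · simpa [h] using hy ⟨i, h⟩
        · simp [h]
      · exact dif_neg fun h => hi (hJ h)
      · rw [← Finset.sum_subset (Finset.subset_univ J) (fun i _ hi => by simp [hi]),
          ← Finset.sum_coe_sort J, Fintype.linearCombination_apply]
        exact Finset.sum_congr rfl fun i _ => by simp
  rw [h]
  refine isClosed_biUnion_finset fun J hJ => ?_
  have hli := (Finset.mem_filter.mp hJ).2
  have hinj : LinearMap.ker (Fintype.linearCombination ℝ (fun i : J => u i)) = ⊥ :=
    LinearMap.ker_eq_bot.mpr (LinearIndependent.fintypeLinearCombination_injective hli)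
  exact (LinearMap.isClosedEmbedding_of_injective hinj).isClosedMap _ isClosed_Ici

lemma add_mem_genCone {ι E : Type*} [Fintype ι] [AddCommGroup E] [Module ℝ E] {u : ι → E}
    {A : Finset ι} {x y : E} (hx : x ∈ genCone u A) (hy : y ∈ genCone u A) :
    x + y ∈ genCone u A := by
  obtain ⟨μ, h1, h2, rfl⟩ := hx
  obtain ⟨ν, h3, h4, rfl⟩ := hy
  exact ⟨μ + ν, add_nonneg h1 h3, fun i hi => by simp [h2 i hi, h4 i hi],
    by simp [add_smul, Finset.sum_add_distrib]⟩

lemma smul_mem_genCone {ι E : Type*} [Fintype ι] [AddCommGroup E] [Module ℝ E] {u : ι → E}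
    {A : Finset ι} {x : E} {t : ℝ} (ht : 0 ≤ t) (hx : x ∈ genCone u A) :
    t • x ∈ genCone u A := by
  obtain ⟨μ, h1, h2, rfl⟩ := hx
  exact ⟨t • μ, smul_nonneg ht h1, fun i hi => by simp [h2 i hi],
    by simp [Finset.smul_sum, mul_smul]⟩

lemma zero_mem_genCone {ι E : Type*} [Fintype ι] [AddCommGroup E] [Module ℝ E] (u : ι → E)
    (A : Finset ι) : 0 ∈ genCone u A :=
  ⟨0, le_rfl, fun _ _ => rfl, by simp⟩

lemma generator_mem_genCone {ι E : Type*} [Fintype ι] [AddCommGroup E] [Module ℝ E] (u : ι → E)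
    {A : Finset ι} {i : ι} (hi : i ∈ A) : u i ∈ genCone u A := by
  classical
  refine ⟨Pi.single i 1, Pi.single_nonneg.mpr zero_le_one, fun k hk => ?_, ?_⟩
  · exact Pi.single_eq_of_ne (by rintro rfl; exact hk hi) _
  · rw [Finset.sum_eq_single i (fun k _ hk => by simp [Pi.single_eq_of_ne hk]) (by simp)]
    simp

/-- A vector whose inner products with all directions in the dual of a finitely generated cone
are nonnegative lies in the cone. -/
lemma mem_genCone_of_inner_nonneg {ι E : Type*} [Fintype ι] [NormedAddCommGroup E]
    [InnerProductSpace ℝ E] [FiniteDimensional ℝ E] {u : ι → E} {A : Finset ι} {z : E}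
    (hz : ∀ d, (∀ i ∈ A, 0 ≤ ⟪u i, d⟫) → 0 ≤ ⟪z, d⟫) : z ∈ genCone u A := by
  have hconv : Convex ℝ (genCone u A) := fun x hx y hy a b ha hb _ =>
    add_mem_genCone (smul_mem_genCone ha hx) (smul_mem_genCone hb hy)
  obtain ⟨c, hc, hmin⟩ := exists_norm_eq_iInf_of_complete_convex
    ⟨0, zero_mem_genCone u A⟩ (isClosed_genCone u A).isComplete hconv z
  have hvi := (norm_eq_iInf_iff_real_inner_le_zero hconv hc).mp hmin
  -- Here `c` is the projection of `z` onto the cone. Testing the variational inequality at `0` and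
  -- `2c` gives orthogonality; testing at `c + u i` shows that `c - z` is an admissible direction in
  -- `hz`.
  have h1 : ⟪z - c, c⟫ = 0 := by
    have h2 := hvi 0 (zero_mem_genCone u A)
    have h3 := hvi (c + c) (add_mem_genCone hc hc)
    rw [add_sub_cancel_right] at h3
    rw [zero_sub, inner_neg_right] at h2
    linarith
  have h2 : ∀ i ∈ A, 0 ≤ ⟪u i, c - z⟫ := fun i hi => by
    have h := hvi (c + u i) (add_mem_genCone hc (generator_mem_genCone u hi))
    rw [add_sub_cancel_left, ← neg_sub, inner_neg_left, real_inner_comm] at h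
    linarith
  have h3 := hz _ h2
  have h4 : ⟪z - c, z - c⟫ ≤ 0 := by
    have : ⟪z - c, z - c⟫ = -⟪z, c - z⟫ - ⟪z - c, c⟫ := by
      simp only [inner_sub_left, inner_sub_right, real_inner_comm]
      ring
    linarith
  have h5 : z - c = 0 := inner_self_eq_zero.mp (le_antisymm h4 real_inner_self_nonneg)
  rwa [sub_eq_zero.mp h5]

/-- The point of a polyhedron nearest to the origin is a conic combination of linearly
independent normals of active constraints. -/
lemma exists_kkt_inner {ι E : Type*} [Fintype ι] [NormedAddCommGroup E]
    [InnerProductSpace ℝ E] [FiniteDimensional ℝ E] (u : ι → E) (e : ι → ℝ)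
    (hne : ∃ w, ∀ i, 0 ≤ ⟪u i, w⟫ + e i) :
    ∃ (J : Finset ι) (μ : ι → ℝ), LinearIndependent ℝ (fun i : J => u i) ∧ 0 ≤ μ ∧
      (∀ i ∉ J, μ i = 0) ∧ (∀ i, 0 ≤ ⟪u i, ∑ k, μ k • u k⟫ + e i) ∧
      ∀ i ∈ J, ⟪u i, ∑ k, μ k • u k⟫ + e i = 0 := by
  classical
  let K : Set E := {w | ∀ i, 0 ≤ ⟪u i, w⟫ + e i}
  have hclosed : IsClosed K := by
    have : K = ⋂ i, {w | 0 ≤ ⟪u i, w⟫ + e i} := by ext; simp [K]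
    rw [this]
    exact isClosed_iInter fun i => isClosed_le continuous_const (by fun_prop)
  have hconv : Convex ℝ K := fun x hx y hy a b ha hb hab i => by
    have h1 := mul_nonneg ha (hx i)
    have h2 := mul_nonneg hb (hy i)
    rw [inner_add_right, inner_smul_right, inner_smul_right]
    have h3 : e i = a * e i + b * e i := by rw [← add_mul, hab, one_mul]
    rw [h3]
    linarith
  obtain ⟨z, hz, hmin⟩ := exists_norm_eq_iInf_of_complete_convex
    (show K.Nonempty from hne) hclosed.isComplete hconv 0
  have hvi := (norm_eq_iInf_iff_real_inner_le_zero hconv hz).mp hmin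
  let A : Finset ι := Finset.univ.filter fun i => ⟪u i, z⟫ + e i = 0
  have hmem : z ∈ genCone u A := by
    refine mem_genCone_of_inner_nonneg fun d hd => ?_
    -- A direction pairing nonnegatively with the active normals stays feasible for small `t > 0`,
    -- since inactive constraints are strict at `z`. Minimality of `z` then forces `⟪z, d⟫ ≥ 0`.
    have hev : ∀ᶠ t : ℝ in nhdsWithin 0 (Set.Ioi 0), ∀ i, 0 ≤ ⟪u i, z + t • d⟫ + e i := by
      rw [Filter.eventually_all]
      intro i
      by_cases hi : i ∈ A
      · filter_upwards [self_mem_nhdsWithin] with t ht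
        have h1 := hd i hi
        have h2 := (Finset.mem_filter.mp hi).2
        rw [inner_add_right, inner_smul_right]
        have := mul_nonneg (le_of_lt ht) h1
        linarith
      · have hpos : 0 < ⟪u i, z + (0 : ℝ) • d⟫ + e i := by
          rw [zero_smul, add_zero]
          exact lt_of_le_of_ne (hz i) fun h => hi (by simp [A, h.symm])
        have hcont : Continuous fun t : ℝ => ⟪u i, z + t • d⟫ + e i := by fun_prop
        exact ((hcont.tendsto 0).eventually (lt_mem_nhds hpos)).filter_mono nhdsWithin_le_nhds
          |>.mono fun t ht => le_of_lt ht
    obtain ⟨t, ht, htpos⟩ := (hev.and self_mem_nhdsWithin).exists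
    have h1 := hvi _ ht
    rw [add_sub_cancel_left, zero_sub, inner_neg_left, inner_smul_right] at h1
    have h2 : (0 : ℝ) < t := htpos
    by_contra hcon
    have := mul_pos_of_neg_of_neg (not_le.mp hcon) (neg_lt_zero.mpr h2)
    linarith
  obtain ⟨μ, h1, h2, h3⟩ := hmem
  obtain ⟨J, hJ, ν, h4, h5, h6, h7⟩ := exists_linearIndependent_conic u A μ h1 h2
  rw [h3] at h6
  refine ⟨J, ν, h7, h4, h5, fun i => ?_, fun i hi => ?_⟩
  · rw [h6]; exact hz i
  · rw [h6]; exact (Finset.mem_filter.mp (hJ hi)).2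

/-! ### The quadratic program `min |z|²` subject to `V z + e ≥ 0` -/

open Matrix

/-- The multiplier is twice the one from `exists_kkt_inner`, to offset the factor `½` in the Gram
matrix. -/
lemma exists_kkt {ι κ : Type*} [Fintype ι] [Fintype κ] (V : Matrix ι κ ℝ) (e : ι → ℝ)
    (hne : ∃ w, 0 ≤ V *ᵥ w + e) :
    ∃ (J : Finset ι) (μ : ι → ℝ), LinearIndependent ℝ (fun i : J => V i) ∧ 0 ≤ μ ∧
      (∀ i ∉ J, μ i = 0) ∧ 0 ≤ ((1 / 2 : ℝ) • (V * Vᵀ)) *ᵥ μ + e ∧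
      ∀ i ∈ J, (((1 / 2 : ℝ) • (V * Vᵀ)) *ᵥ μ + e) i = 0 := by
  let u : ι → EuclideanSpace ℝ κ := fun i => WithLp.toLp 2 (V i)
  have hu : ∀ (w : κ → ℝ) i, ⟪u i, WithLp.toLp 2 w⟫ = (V *ᵥ w) i := fun w i => by
    rw [EuclideanSpace.inner_eq_star_dotProduct]
    simp [u, mulVec, dotProduct_comm]
  have hsum : ∀ μ : ι → ℝ, ∑ k, μ k • u k = WithLp.toLp 2 (Vᵀ *ᵥ μ) := fun μ => by
    ext j
    simp [u, mulVec, dotProduct, mul_comm]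
  obtain ⟨w, hw⟩ := hne
  obtain ⟨J, μ, h1, h2, h3, h4, h5⟩ := exists_kkt_inner u e
    ⟨WithLp.toLp 2 w, fun i => by rw [hu]; exact hw i⟩
  have key : ((1 / 2 : ℝ) • (V * Vᵀ)) *ᵥ ((2 : ℝ) • μ) = V *ᵥ (Vᵀ *ᵥ μ) := by
    rw [mulVec_smul, smul_mulVec, smul_smul, mulVec_mulVec]
    norm_num
  refine ⟨J, (2 : ℝ) • μ, ?_, smul_nonneg zero_le_two h2, fun i hi => by simp [h3 i hi], ?_, ?_⟩
  · exact h1.map' (WithLp.linearEquiv 2 ℝ (κ → ℝ)).toLinearMap (LinearEquiv.ker _)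
  · intro i
    have := h4 i
    rw [hsum, hu] at this
    rw [key]
    exact this
  · intro i hi
    have := h5 i hi
    rw [hsum, hu] at this
    rw [key]
    exact this

/-- Sufficiency of the Karush-Kuhn-Tucker conditions. -/
lemma kkt_sufficient {ι κ : Type*} [Fintype ι] [Fintype κ] {V : Matrix ι κ ℝ} {e μ : ι → ℝ}
    (hμ : 0 ≤ μ)
    (hcomp : ∀ i, μ i * (((1 / 2 : ℝ) • (V * Vᵀ)) *ᵥ μ + e) i = 0) {w : κ → ℝ}
    (hw : 0 ≤ V *ᵥ w + e) :
    (((1 / 2 : ℝ) • (Vᵀ *ᵥ μ)) ⬝ᵥ ((1 / 2 : ℝ) • (Vᵀ *ᵥ μ)))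
      + ((w - (1 / 2 : ℝ) • (Vᵀ *ᵥ μ)) ⬝ᵥ (w - (1 / 2 : ℝ) • (Vᵀ *ᵥ μ))) ≤ w ⬝ᵥ w := by
  set z : κ → ℝ := (1 / 2 : ℝ) • (Vᵀ *ᵥ μ) with hz
  have hVz : ((1 / 2 : ℝ) • (V * Vᵀ)) *ᵥ μ = V *ᵥ z := by
    rw [hz, mulVec_smul, smul_mulVec, mulVec_mulVec]
  rw [hVz] at hcomp
  -- Complementarity removes the contribution of `V z + e`, so the cross term is half the pairing of
  -- `μ` with the slack of `w`, hence nonnegative.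
  have h1 : (w - z) ⬝ᵥ z = (1 / 2 : ℝ) * (μ ⬝ᵥ (V *ᵥ w + e)) := by
    have h2 : μ ⬝ᵥ (V *ᵥ z + e) = 0 := Finset.sum_eq_zero fun i _ => hcomp i
    have h3 : (w - z) ⬝ᵥ z = (1 / 2 : ℝ) * (μ ⬝ᵥ (V *ᵥ (w - z))) := by
      rw [dotProduct_comm]
      nth_rewrite 1 [hz]
      rw [smul_dotProduct, smul_eq_mul, mulVec_transpose, dotProduct_mulVec]
    rw [h3]
    have h4 : V *ᵥ (w - z) = (V *ᵥ w + e) - (V *ᵥ z + e) := by rw [mulVec_sub]; abel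
    rw [h4, dotProduct_sub, h2, sub_zero]
  have h5 : 0 ≤ μ ⬝ᵥ (V *ᵥ w + e) := Finset.sum_nonneg fun i _ => mul_nonneg (hμ i) (hw i)
  have h6 : w ⬝ᵥ w = z ⬝ᵥ z + 2 * ((w - z) ⬝ᵥ z) + (w - z) ⬝ᵥ (w - z) := by
    simp only [sub_dotProduct, dotProduct_sub, dotProduct_comm w z]
    ring
  rw [h6, h1]
  linarith

lemma isUnit_det_of_rank_eq {κ : Type*} [Fintype κ] [DecidableEq κ] {A : Matrix κ κ ℝ}
    (h : A.rank = Fintype.card κ) : IsUnit A.det := by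
  rw [← Matrix.isUnit_iff_isUnit_det, ← Matrix.linearIndependent_rows_iff_isUnit,
    linearIndependent_iff_card_eq_finrank_span, ← h, Matrix.rank_eq_finrank_span_row]
  rfl

/-! ### Legendre coordinates -/

lemma matU_apply (m n : ℕ) (i : Fin (n + 1)) (j : Fin (m + 1)) :
    matU m n i j = √(2 * (j : ℝ) + 1) * legendreElev j n i := by
  rw [matU, mulVec, dotProduct, legendreElev, ← Fin.sum_univ_eq_sum_range (fun k =>
    (if k ≤ (i : ℕ) then ((j : ℕ).choose k : ℝ) * ((n - (j : ℕ)).choose ((i : ℕ) - k) : ℝ)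
      / (n.choose i : ℝ) else 0) * ((-1) ^ ((j : ℕ) + k) * ((j : ℕ).choose k : ℝ)))]
  rfl

lemma matU_zero (m n : ℕ) (i : Fin (n + 1)) : matU m n i 0 = 1 := by
  have : (n.choose i : ℝ) ≠ 0 := by exact_mod_cast (Nat.choose_pos (by omega)).ne'
  rw [matU_apply]
  simp [legendreElev, this]

lemma diagonal_mul_matU_transpose_mul_matU {m n : ℕ} (hmn : m ≤ n) :
    diagonal (fun j : Fin (m + 1) => massEigenvalue n j) * ((matU m n)ᵀ * matU m n) = 1 := by
  ext j k
  have h := sum_legendreElev_mul (show (j : ℕ) ≤ n by omega) (show (k : ℕ) ≤ n by omega)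
  have h1 : √(2 * (j : ℝ) + 1) * √(2 * (j : ℝ) + 1) = 2 * (j : ℝ) + 1 :=
    Real.mul_self_sqrt (by positivity)
  rw [diagonal_mul, mul_apply]
  simp only [transpose_apply, matU_apply]
  rw [Fin.sum_univ_eq_sum_range (fun i => √(2 * (j : ℝ) + 1) * legendreElev j n i
    * (√(2 * (k : ℝ) + 1) * legendreElev k n i)) (n + 1)]
  have h2 : ∑ i ∈ Finset.range (n + 1), √(2 * (j : ℝ) + 1) * legendreElev j n i
      * (√(2 * (k : ℝ) + 1) * legendreElev k n i)
      = √(2 * (j : ℝ) + 1) * √(2 * (k : ℝ) + 1) * ∑ i ∈ Finset.range (n + 1),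
        legendreElev j n i * legendreElev k n i := by
    rw [Finset.mul_sum]
    exact Finset.sum_congr rfl fun i _ => by ring
  rw [h2, mul_left_comm, h]
  by_cases hjk : j = k
  · subst hjk
    have : 2 * (j : ℝ) + 1 ≠ 0 := by positivity
    rw [if_pos rfl, h1, one_apply_eq]
    field_simp
  · rw [if_neg fun h => hjk (Fin.ext h), mul_zero, one_apply_ne hjk]

lemma diagonal_mulVec_matU {m n : ℕ} (hmn : m ≤ n) (z : Fin (m + 1) → ℝ) :
    diagonal (fun j : Fin (m + 1) => massEigenvalue n j) *ᵥ ((matU m n)ᵀ *ᵥ (matU m n *ᵥ z))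
      = z := by
  rw [mulVec_mulVec, mulVec_mulVec, Matrix.mul_assoc, diagonal_mul_matU_transpose_mul_matU hmn, one_mulVec]

lemma coe_eq_sum_bernsteinCoeff {m : ℕ} (q : PolyLE m) :
    (q : ℝ[X]) = ∑ i, C (bernsteinCoeff q i) * bernsteinPolynomial ℝ m (i : Fin (m + 1)) := by
  have h := congrArg Subtype.val ((bernsteinBasis m).sum_equivFun q)
  rw [← h]
  simp only [Submodule.coe_sum, Submodule.coe_smul, bernsteinBasis_apply, smul_eq_C_mul,
    bernsteinCoeff]

lemma bernsteinCoeff_injective {m : ℕ} {q r : PolyLE m} (h : bernsteinCoeff q = bernsteinCoeff r) :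
    q = r := (bernsteinBasis m).equivFun.injective h

/-- Elevating `L^j` to degree `m` and then to `n` yields its degree-`n` coefficients, which are
unique. -/
lemma elevation_mul_matU {m n : ℕ} (hmn : m ≤ n) : elevation m n * matU m m = matU m n := by
  ext i j
  have hj : (j : ℕ) ≤ m := by omega
  have h : ∑ i ∈ Finset.range (n + 1), C (∑ k ∈ Finset.range (m + 1),
      (if k ≤ i then (m.choose k : ℝ) * ((n - m).choose (i - k) : ℝ) / (n.choose i : ℝ) else 0)
        * legendreElev j m k) * bernsteinPolynomial ℝ n i
      = ∑ i ∈ Finset.range (n + 1), C (legendreElev j n i) * bernsteinPolynomial ℝ n i := by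
    rw [← legendrePoly_eq_sum (hj.trans hmn), legendrePoly_eq_sum hj]
    simp only [map_sum, Finset.sum_mul]
    rw [Finset.sum_comm]
    refine Finset.sum_congr rfl fun k hk => ?_
    rw [bernsteinPolynomial_elevation (Finset.mem_range_succ_iff.mp hk) hmn, Finset.mul_sum]
    refine Finset.sum_congr rfl fun i _ => ?_
    rw [C_mul]
    ring
  have h2 := bernsteinPolynomial_sum_injective h (show (i : ℕ) ≤ n by omega)
  rw [mul_apply, matU_apply, ← h2, Finset.mul_sum,
    ← Fin.sum_univ_eq_sum_range (fun k => √(2 * (j : ℝ) + 1) * ((if k ≤ (i : ℕ) then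
      (m.choose k : ℝ) * ((n - m).choose (i - k) : ℝ) / (n.choose i : ℝ) else 0)
        * legendreElev j m k))]
  refine Finset.sum_congr rfl fun k _ => ?_
  rw [matU_apply, elevation]
  ring

/-- The coordinates of a polynomial in the orthonormal Legendre basis. -/
def legendreCoord {m : ℕ} (q : PolyLE m) : Fin (m + 1) → ℝ :=
  diagonal (fun j : Fin (m + 1) => massEigenvalue m j) *ᵥ ((matU m m)ᵀ *ᵥ bernsteinCoeff q)

/-- The polynomial with given coordinates in the orthonormal Legendre basis. -/
def ofLegendre {m : ℕ} (z : Fin (m + 1) → ℝ) : PolyLE m :=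
  (bernsteinBasis m).equivFun.symm (matU m m *ᵥ z)

lemma bernsteinCoeff_ofLegendre {m : ℕ} (z : Fin (m + 1) → ℝ) :
    bernsteinCoeff (ofLegendre z) = matU m m *ᵥ z :=
  (bernsteinBasis m).equivFun.apply_symm_apply _

lemma matU_mulVec_legendreCoord {m : ℕ} (q : PolyLE m) :
    matU m m *ᵥ legendreCoord q = bernsteinCoeff q := by
  have h := diagonal_mul_matU_transpose_mul_matU (le_refl m)
  rw [← Matrix.mul_assoc] at h
  rw [legendreCoord, mulVec_mulVec, mulVec_mulVec, Matrix.mul_assoc, mul_eq_one_comm.mp h,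
    one_mulVec]

lemma legendreCoord_ofLegendre {m : ℕ} (z : Fin (m + 1) → ℝ) :
    legendreCoord (ofLegendre z) = z := by
  rw [legendreCoord, bernsteinCoeff_ofLegendre, diagonal_mulVec_matU le_rfl]

lemma legendreCoord_injective {m : ℕ} {q r : PolyLE m} (h : legendreCoord q = legendreCoord r) :
    q = r :=
  bernsteinCoeff_injective (by rw [← matU_mulVec_legendreCoord q, h, matU_mulVec_legendreCoord])

lemma elevation_mulVec_bernsteinCoeff {m n : ℕ} (hmn : m ≤ n) (q : PolyLE m) :
    elevation m n *ᵥ bernsteinCoeff q = matU m n *ᵥ legendreCoord q := by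
  rw [← matU_mulVec_legendreCoord, mulVec_mulVec, elevation_mul_matU hmn]

lemma coe_eq_sum_legendreCoord {m : ℕ} (q : PolyLE m) :
    (q : ℝ[X]) = ∑ j, C (legendreCoord q j * √(2 * ((j : Fin (m + 1)) : ℝ) + 1))
      * legendrePoly j := by
  rw [coe_eq_sum_bernsteinCoeff, ← matU_mulVec_legendreCoord q]
  simp only [mulVec, dotProduct, map_sum, Finset.sum_mul]
  rw [Finset.sum_comm]
  refine Finset.sum_congr rfl fun j _ => ?_
  rw [legendrePoly_eq_sum (show (j : ℕ) ≤ m by omega), Finset.mul_sum, ← Fin.sum_univ_eq_sum_range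
    (fun i => C (legendreCoord q j * √(2 * (j : ℝ) + 1)) * (C (legendreElev j m i)
      * bernsteinPolynomial ℝ m i))]
  refine Finset.sum_congr rfl fun i _ => ?_
  rw [matU_apply, ← mul_assoc, ← C_mul]
  congr 2
  ring

lemma mass_sum_legendre_mul {m : ℕ} (a b : Fin (m + 1) → ℝ) :
    mass ((∑ j, C (a j * √(2 * ((j : Fin (m + 1)) : ℝ) + 1)) * legendrePoly j)
      * (∑ j, C (b j * √(2 * ((j : Fin (m + 1)) : ℝ) + 1)) * legendrePoly j)) = a ⬝ᵥ b := by
  rw [Finset.sum_mul_sum, mass_sum, dotProduct]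
  refine Finset.sum_congr rfl fun j _ => ?_
  rw [mass_sum, Finset.sum_eq_single j]
  · rw [show ∀ x y u v : ℝ[X], x * u * (y * v) = x * (y * (u * v)) by intros; ring,
      mass_C_mul, mass_C_mul, mass_legendrePoly_mul_eq, if_pos rfl]
    have h1 : √(2 * (j : ℝ) + 1) * √(2 * (j : ℝ) + 1) = 2 * (j : ℝ) + 1 :=
      Real.mul_self_sqrt (by positivity)
    have h2 : 2 * (j : ℝ) + 1 ≠ 0 := by positivity
    field_simp
    linear_combination a j * b j * h1
  · intro k _ hk
    rw [show ∀ x y u v : ℝ[X], x * u * (y * v) = x * (y * (u * v)) by intros; ring,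
      mass_C_mul, mass_C_mul, mass_legendrePoly_mul_eq, if_neg fun h => hk (Fin.ext h.symm)]
    simp
  · simp

lemma l2norm_sub {m : ℕ} (p q : PolyLE m) :
    l2norm ((p : ℝ[X]) - q)
      = √((legendreCoord q - legendreCoord p) ⬝ᵥ (legendreCoord q - legendreCoord p)) := by
  rw [← mass_sum_legendre_mul]
  have h : (∑ j, C ((legendreCoord q - legendreCoord p) j * √(2 * ((j : Fin (m + 1)) : ℝ) + 1))
      * legendrePoly j) = (q : ℝ[X]) - p := by
    rw [coe_eq_sum_legendreCoord q, coe_eq_sum_legendreCoord p, ← Finset.sum_sub_distrib]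
    simp only [Pi.sub_apply, sub_mul, C_sub]
  rw [h, l2norm, mass]
  congr 2
  ext x
  simp only [eval_sub, eval_mul]
  ring

/-- The constant `1` is the first vector of the orthonormal basis. -/
lemma mass_eq_legendreCoord_zero {m : ℕ} (q : PolyLE m) : mass (q : ℝ[X]) = legendreCoord q 0 := by
  have h1 : (∑ j, C ((Pi.single 0 1 : Fin (m + 1) → ℝ) j * √(2 * ((j : Fin (m + 1)) : ℝ) + 1))
      * legendrePoly j) = (1 : ℝ[X]) := by
    rw [Finset.sum_eq_single 0 (fun j _ hj => by simp [hj]) (by simp)]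
    simp [legendrePoly, bernsteinPolynomial]
  have h2 := mass_sum_legendre_mul (legendreCoord q) (Pi.single 0 1)
  rw [h1, mul_one, ← coe_eq_sum_legendreCoord] at h2
  simpa using h2

/-- The surplus `|r - q|²` in the hypothesis does double duty: its sign gives optimality, and it
must vanish for any other minimizer. -/
lemma existsUnique_isBestApprox {m : ℕ} {S : Set (PolyLE m)} {p q : PolyLE m} (hq : q ∈ S)
    (h : ∀ r ∈ S, (legendreCoord q - legendreCoord p) ⬝ᵥ (legendreCoord q - legendreCoord p)
      + (legendreCoord r - legendreCoord q) ⬝ᵥ (legendreCoord r - legendreCoord q)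
      ≤ (legendreCoord r - legendreCoord p) ⬝ᵥ (legendreCoord r - legendreCoord p)) :
    IsBestApprox S p q ∧ ∀ r, IsBestApprox S p r → r = q := by
  have hnn : ∀ v : Fin (m + 1) → ℝ, 0 ≤ v ⬝ᵥ v := fun v =>
    Finset.sum_nonneg fun i _ => mul_self_nonneg (v i)
  refine ⟨⟨hq, fun r hr => ?_⟩, fun r hr => ?_⟩
  · rw [l2norm_sub, l2norm_sub]
    exact Real.sqrt_le_sqrt (by linarith [h r hr, hnn (legendreCoord r - legendreCoord q)])
  · have h1 := hr.2 q hq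
    rw [l2norm_sub, l2norm_sub, Real.sqrt_le_sqrt_iff (hnn _)] at h1
    have h2 : (legendreCoord r - legendreCoord q) ⬝ᵥ (legendreCoord r - legendreCoord q) = 0 :=
      le_antisymm (by linarith [h r hr.1]) (hnn _)
    exact legendreCoord_injective (sub_eq_zero.mp (dotProduct_self_eq_zero.mp h2))

/-! ### Active sets -/

/-- The matrix of the linear system for the active set `J`. -/
def activeMatrix {ι : Type*} (W : Matrix ι ι ℝ) (J : Finset ι) : Matrix J J ℝ := fun i j => W i j

/-- The solution of the linear system for the active set `J`. -/
def activeSolution {n : ℕ} (W : Matrix (Fin (n + 1)) (Fin (n + 1)) ℝ) (e : Fin (n + 1) → ℝ)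
    (J : Finset (Fin (n + 1))) : J → ℝ := (activeMatrix W J)⁻¹ *ᵥ fun i : J => -e i

/-- The multiplier belonging to the active set `J`. -/
def activeMultiplier {n : ℕ} (W : Matrix (Fin (n + 1)) (Fin (n + 1)) ℝ) (e : Fin (n + 1) → ℝ)
    (J : Finset (Fin (n + 1))) : Fin (n + 1) → ℝ := extendByZero J (activeSolution W e J)

/-- The active set `J` passes all tests of the loop. -/
def Accepted {n : ℕ} (W : Matrix (Fin (n + 1)) (Fin (n + 1)) ℝ) (e : Fin (n + 1) → ℝ)
    (J : Finset (Fin (n + 1))) : Prop :=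
  (activeMatrix W J).rank = Fintype.card J ∧ 0 ≤ activeSolution W e J ∧
    0 ≤ W *ᵥ activeMultiplier W e J + e

lemma extendByZero_nonneg {n : ℕ} {J : Finset (Fin (n + 1))} {x : J → ℝ} (hx : 0 ≤ x) :
    0 ≤ extendByZero J x := fun i => by
  by_cases h : i ∈ J
  · simpa [extendByZero, h] using hx ⟨i, h⟩
  · simp [extendByZero, h]

lemma extendByZero_of_notMem {n : ℕ} {J : Finset (Fin (n + 1))} (x : J → ℝ) {i : Fin (n + 1)}
    (hi : i ∉ J) : extendByZero J x i = 0 := dif_neg hi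

lemma extendByZero_restrict {n : ℕ} {J : Finset (Fin (n + 1))} {μ : Fin (n + 1) → ℝ}
    (hμ : ∀ i ∉ J, μ i = 0) : extendByZero J (fun i => μ i) = μ := by
  ext i
  by_cases h : i ∈ J
  · simp [extendByZero, h]
  · simp [extendByZero, h, hμ i h]

lemma mulVec_extendByZero {n : ℕ} (W : Matrix (Fin (n + 1)) (Fin (n + 1)) ℝ)
    {J : Finset (Fin (n + 1))} (x : J → ℝ) (i : J) :
    (W *ᵥ extendByZero J x) i = (activeMatrix W J *ᵥ x) i := by
  rw [mulVec, dotProduct, ← Finset.sum_subset (Finset.subset_univ J)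
    (fun i _ hi => by rw [extendByZero_of_notMem x hi, mul_zero]), ← Finset.sum_coe_sort J]
  exact Finset.sum_congr rfl fun j _ => by simp [extendByZero, activeMatrix]

/-- On `J` the linear system makes the slack zero; off `J` the multiplier is zero. -/
lemma activeMultiplier_complementary {n : ℕ} {W : Matrix (Fin (n + 1)) (Fin (n + 1)) ℝ}
    {e : Fin (n + 1) → ℝ} {J : Finset (Fin (n + 1))}
    (hJ : (activeMatrix W J).rank = Fintype.card J) (i : Fin (n + 1)) :
    activeMultiplier W e J i * (W *ᵥ activeMultiplier W e J + e) i = 0 := by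
  by_cases hi : i ∈ J
  · have h := mulVec_extendByZero W (activeSolution W e J) ⟨i, hi⟩
    rw [activeSolution, mulVec_mulVec, Matrix.mul_nonsing_inv _ (isUnit_det_of_rank_eq hJ),
      one_mulVec] at h
    rw [Pi.add_apply, activeMultiplier, activeSolution, h, neg_add_cancel, mul_zero]
  · rw [activeMultiplier, extendByZero_of_notMem _ hi, zero_mul]

lemma activeMatrix_gram {ι κ : Type*} [Fintype κ] (V : Matrix ι κ ℝ) (J : Finset ι) :
    activeMatrix ((1 / 2 : ℝ) • (V * Vᵀ)) J
      = ((1 / 2 : ℝ) • V.submatrix (fun i : J => (i : ι)) id)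
        * (V.submatrix (fun i : J => (i : ι)) id)ᵀ := by
  ext i j
  simp [activeMatrix, mul_apply, Finset.mul_sum, mul_assoc]

/-- The block factors through `κ`-dimensional space. This bounds the cost of forming `W μ`. -/
lemma card_le_of_rank_activeMatrix_eq {ι κ : Type*} [Fintype κ] {V : Matrix ι κ ℝ}
    {J : Finset ι} (h : (activeMatrix ((1 / 2 : ℝ) • (V * Vᵀ)) J).rank = Fintype.card J) :
    J.card ≤ Fintype.card κ := by
  rw [← Fintype.card_coe, ← h, activeMatrix_gram]
  exact (rank_mul_le_left _ _).trans (rank_le_card_width _)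

lemma rank_activeMatrix_eq {ι κ : Type*} [Fintype κ] {V : Matrix ι κ ℝ} {J : Finset ι}
    (h : LinearIndependent ℝ (fun i : J => V i)) :
    (activeMatrix ((1 / 2 : ℝ) • (V * Vᵀ)) J).rank = Fintype.card J := by
  have h1 : (V.submatrix (fun i : J => (i : ι)) id).rank = Fintype.card J :=
    LinearIndependent.rank_matrix h
  rw [activeMatrix_gram, smul_mul, ← h1,
    ← rank_self_mul_transpose (V.submatrix (fun i : J => (i : ι)) id)]
  exact rank_smul_of_mem_nonZeroDivisors _ (mem_nonZeroDivisors_of_ne_zero (by norm_num))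

/-- Independence of the active rows makes the block on `J` nonsingular, so the computed solution can
only be the KKT multiplier. -/
lemma exists_accepted {n : ℕ} {κ : Type*} [Fintype κ] (V : Matrix (Fin (n + 1)) κ ℝ)
    (e : Fin (n + 1) → ℝ) (hne : ∃ w, 0 ≤ V *ᵥ w + e) :
    ∃ J, Accepted ((1 / 2 : ℝ) • (V * Vᵀ)) e J := by
  obtain ⟨J, μ, h1, h2, h3, h4, h5⟩ := exists_kkt V e hne
  have hr := rank_activeMatrix_eq h1
  have hx : activeSolution ((1 / 2 : ℝ) • (V * Vᵀ)) e J = fun i : J => μ i := by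
    have h6 : (activeMatrix ((1 / 2 : ℝ) • (V * Vᵀ)) J *ᵥ fun i : J => μ i)
        = fun i : J => -e i := by
      ext i
      rw [← mulVec_extendByZero, extendByZero_restrict h3]
      have := h5 i i.2
      rw [Pi.add_apply] at this
      linarith
    rw [activeSolution, ← h6, mulVec_mulVec, Matrix.nonsing_inv_mul _ (isUnit_det_of_rank_eq hr),
      one_mulVec]
  refine ⟨J, hr, ?_, ?_⟩
  · rw [hx]; exact fun i => h2 i
  · rw [activeMultiplier, hx, extendByZero_restrict h3]; exact h4

/-! ### Cost of programs -/

/-- Started from the tally `t`, the program `c` computes `v` and leaves the tally `t'`. -/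
def Runs {α : Type} (c : Counted α) (t : Tally) (v : α) (t' : Tally) : Prop :=
  StateT.run c t = (v, t')

/-- The tally `t` with `k` further operations. -/
def Tally.addFlops (t : Tally) (k : ℕ) : Tally := { t with flops := t.flops + k }

lemma Tally.addFlops_addFlops (t : Tally) (a b : ℕ) :
    (t.addFlops a).addFlops b = t.addFlops (a + b) := by
  simp [Tally.addFlops, add_assoc]

lemma Tally.addFlops_zero (t : Tally) : t.addFlops 0 = t := rfl

lemma Runs.bind {α β : Type} {c : Counted α} {f : α → Counted β} {t t₁ t₂ : Tally} {v : α} {w : β}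
    (h : Runs c t v t₁) (h' : Runs (f v) t₁ w t₂) : Runs (c >>= f) t w t₂ := by
  unfold Runs at *
  rw [StateT.run_bind, h]
  exact h'

lemma Runs.pure {α : Type} (t : Tally) (v : α) : Runs (Pure.pure v) t v t := rfl

lemma Runs.ite_pos {α : Type} {p : Prop} {_ : Decidable p} {c d : Counted α} {t t' : Tally} {v : α}
    (hp : p) (h : Runs c t v t') : Runs (if p then c else d) t v t' := by rwa [if_pos hp]

lemma Runs.ite_neg {α : Type} {p : Prop} {_ : Decidable p} {c d : Counted α} {t t' : Tally} {v : α}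
    (hp : ¬p) (h : Runs d t v t') : Runs (if p then c else d) t v t' := by rwa [if_neg hp]

lemma runs_mulOp (t : Tally) (x y : ℝ) : Runs (mulOp x y) t (x * y) (t.addFlops 1) := rfl

lemma runs_addOp (t : Tally) (x y : ℝ) : Runs (addOp x y) t (x + y) (t.addFlops 1) := rfl

lemma runs_subOp (t : Tally) (x y : ℝ) : Runs (subOp x y) t (x - y) (t.addFlops 1) := rfl

lemma runs_divOp (t : Tally) (x y : ℝ) : Runs (divOp x y) t (x / y) (t.addFlops 1) := rfl

lemma runs_sumList (l : List ℝ) (t : Tally) :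
    Runs (sumList l) t l.sum (t.addFlops (l.length - 1)) := by
  induction l generalizing t with
  | nil => exact Runs.pure _ _
  | cons a l ih =>
    rcases l with _ | ⟨b, l⟩
    · rw [List.sum_singleton]; exact Runs.pure t a
    · have h := (ih t).bind (f := fun s => addOp a s) (runs_addOp _ a _)
      rw [Tally.addFlops_addFlops] at h
      exact h

/-- Truncated subtraction gives the empty product cost `0`, which covers `J = ∅`. -/
lemma runs_dot (l : List (ℝ × ℝ)) (t : Tally) :
    Runs (dot l) t (l.map fun ab => ab.1 * ab.2).sum (t.addFlops (2 * l.length - 1)) := by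
  induction l generalizing t with
  | nil => exact Runs.pure _ _
  | cons a l ih =>
    rcases l with _ | ⟨b, l⟩
    · rw [List.map_singleton, List.sum_singleton]; exact runs_mulOp t a.1 a.2
    · have h := (ih t).bind (f := fun s => do let r ← mulOp a.1 a.2; addOp r s)
        ((runs_mulOp _ a.1 a.2).bind (runs_addOp _ _ _))
      rw [Tally.addFlops_addFlops, Tally.addFlops_addFlops] at h
      simp only [List.length_cons] at h ⊢
      rw [show 2 * (l.length + 1 + 1) - 1 = 2 * (l.length + 1) - 1 + 1 + 1 by omega]
      exact h

lemma runs_tabulate {k : ℕ} {f : Fin k → Counted ℝ} {g : Fin k → ℝ} {a : ℕ}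
    (h : ∀ i t, Runs (f i) t (g i) (t.addFlops a)) (t : Tally) :
    Runs (tabulate k f) t g (t.addFlops (k * a)) := by
  induction k generalizing t with
  | zero =>
    rw [zero_mul, Tally.addFlops_zero, Subsingleton.elim g Fin.elim0]
    exact Runs.pure _ _
  | succ k ih =>
    have h2 := (h 0 t).bind (f := fun x => do
      let v ← tabulate k fun i => f i.succ
      return (Fin.cons x v : Fin (k + 1) → ℝ)) ((ih (fun i t => h i.succ t) _).bind (Runs.pure _ _))
    rw [Tally.addFlops_addFlops] at h2
    rw [show (k + 1) * a = a + k * a by ring]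
    have h3 : (Fin.cons (g 0) fun i => g i.succ : Fin (k + 1) → ℝ) = g := Fin.cons_self_tail g
    rw [h3] at h2
    exact h2

lemma runs_matVec {r c : ℕ} (A : Matrix (Fin r) (Fin c) ℝ) (v : Fin c → ℝ) (t : Tally) :
    Runs (matVec A v) t (A *ᵥ v) (t.addFlops (r * (2 * c - 1))) := by
  refine runs_tabulate (fun i t => ?_) t
  have h := runs_dot (List.ofFn fun j => (A i j, v j)) t
  rw [List.length_ofFn, List.map_ofFn, List.sum_ofFn] at h
  exact h

lemma runs_matVecOn {r c : ℕ} (A : Matrix (Fin r) (Fin c) ℝ) (J : Finset (Fin c)) {v : Fin c → ℝ}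
    (hv : ∀ j ∉ J, v j = 0) (t : Tally) :
    Runs (matVecOn A J v) t (A *ᵥ v) (t.addFlops (r * (2 * J.card - 1))) := by
  refine runs_tabulate (fun i t => ?_) t
  have h := runs_dot (((List.finRange c).filter (· ∈ J)).map fun j => (A i j, v j)) t
  have hnd : ((List.finRange c).filter (· ∈ J)).Nodup := (List.nodup_finRange c).filter _
  have hJ : ((List.finRange c).filter (· ∈ J)).toFinset = J := by ext; simp
  have hlen : ((List.finRange c).filter (· ∈ J)).length = J.card := by
    rw [← List.toFinset_card_of_nodup hnd, hJ]
  rw [List.length_map, hlen, List.map_map, ← List.sum_toFinset _ hnd, hJ] at h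
  rw [mulVec, dotProduct, ← Finset.sum_subset (Finset.subset_univ J)
    (fun j _ hj => by rw [hv j hj, mul_zero])]
  exact h

/-- The vector computed by the degree reduction. -/
def reduceValue (m n : ℕ) (y : Fin (n + 1) → ℝ) : Fin (m + 1) → ℝ :=
  matU m m *ᵥ (diagonal (fun j : Fin (m + 1) => massEigenvalue n j) *ᵥ ((matU m n)ᵀ *ᵥ y))

lemma runs_reduceDegree (m n : ℕ) (y : Fin (n + 1) → ℝ) (t : Tally) :
    Runs (reduceDegree m n y) t (reduceValue m n y)
      (t.addFlops ((m + 1) * (2 * n + 2 * m + 3))) := by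
  have h : Runs (reduceDegree m n y) t (matU m m *ᵥ fun j : Fin (m + 1) =>
      massEigenvalue n j * ((matU m n)ᵀ *ᵥ y) j) _ :=
    Runs.bind (runs_matVec (matU m n)ᵀ y t)
      (Runs.bind (runs_tabulate (fun j t => runs_mulOp t _ _) _) (runs_matVec (matU m m) _ _))
  rw [Tally.addFlops_addFlops, Tally.addFlops_addFlops] at h
  have e : (m + 1) * (2 * (n + 1) - 1) + ((m + 1) * 1 + (m + 1) * (2 * (m + 1) - 1))
      = (m + 1) * (2 * n + 2 * m + 3) := by
    rw [show 2 * (n + 1) - 1 = 2 * n + 1 by omega, show 2 * (m + 1) - 1 = 2 * m + 1 by omega]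
    ring
  rw [e] at h
  have e2 : (fun j : Fin (m + 1) => massEigenvalue n j * ((matU m n)ᵀ *ᵥ y) j)
      = diagonal (fun j : Fin (m + 1) => massEigenvalue n j) *ᵥ ((matU m n)ᵀ *ᵥ y) := by
    ext j; rw [mulVec_diagonal]
  rw [e2] at h
  exact h

/-- The tally after a system of size `k` has been passed to the solver. -/
def Tally.addSolve (t : Tally) (k : ℕ) : Tally := { t with solves := k :: t.solves }

/-- The tally after a nonnegative solution has been found. -/
def Tally.addNonneg (t : Tally) : Tally := { t with nonnegSolutions := t.nonnegSolutions + 1 }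

lemma runs_solve {κ : Type} [Fintype κ] [DecidableEq κ] (A : Matrix κ κ ℝ) (b : κ → ℝ)
    (t : Tally) : Runs (solve A b) t
      (if A.rank = Fintype.card κ then some (A⁻¹ *ᵥ b) else none)
      (t.addSolve (Fintype.card κ)) := by
  unfold solve
  split_ifs <;> rfl

lemma runs_recordNonneg (t : Tally) : Runs recordNonneg t () t.addNonneg := rfl

open Classical in
/-- The value that the loop body returns for the active set `J`. -/
def stepValue (m n : ℕ) (W : Matrix (Fin (n + 1)) (Fin (n + 1)) ℝ) (e : Fin (n + 1) → ℝ)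
    (J : Finset (Fin (n + 1))) : Option (Fin (m + 1) → ℝ) :=
  if Accepted W e J then some (reduceValue m n (W *ᵥ activeMultiplier W e J + e)) else none

/-- A loop body with values `res J` that for each active set solves one system, performs at most
`c` operations if there is a nonnegative solution (and `d` further ones if it succeeds), and none
otherwise. -/
def StepSpec {n : ℕ} {β : Type} (step : Finset (Fin (n + 1)) → Counted (Option β))
    (res : Finset (Fin (n + 1)) → Option β) (c d : ℕ) : Prop :=
  ∀ J t, ∃ f k : ℕ, Runs (step J) t (res J)
    ⟨t.flops + f, J.card :: t.solves, t.nonnegSolutions + k⟩ ∧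
    f ≤ k * c + if (res J).isSome then d else 0

/-- The loop stops at its first success, so `d` is paid at most once. Solver charges are bounded by
those of the whole list, reached or not. -/
lemma StepSpec.findSomeM? {n : ℕ} {β : Type} {step : Finset (Fin (n + 1)) → Counted (Option β)}
    {res : Finset (Fin (n + 1)) → Option β} {c d : ℕ} (h : StepSpec step res c d)
    (Js : List (Finset (Fin (n + 1)))) (t : Tally) :
    ∃ (f k : ℕ) (l : List ℕ), Runs (Js.findSomeM? step) t (Js.findSome? res)
      ⟨t.flops + f, l, t.nonnegSolutions + k⟩ ∧ f ≤ k * c + d ∧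
      (l.map fun k : ℕ => 2 * (k : ℝ) ^ 3 / 3).sum ≤ (t.solves.map fun k : ℕ => 2 * (k : ℝ) ^ 3 / 3).sum
        + (Js.map fun J => 2 * (J.card : ℝ) ^ 3 / 3).sum := by
  induction Js generalizing t with
  | nil => exact ⟨0, 0, t.solves, Runs.pure _ _, by simp, by simp⟩
  | cons J Js ih =>
    obtain ⟨f, k, h1, h2⟩ := h J t
    rw [List.findSomeM?_cons]
    cases hr : res J with
    | some b =>
      rw [hr] at h1 h2
      refine ⟨f, k, J.card :: t.solves, ?_, by simpa using h2, ?_⟩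
      · rw [List.findSome?_cons, hr]
        exact h1.bind (Runs.pure _ _)
      · have : 0 ≤ (Js.map fun J => 2 * (J.card : ℝ) ^ 3 / 3).sum := by
          refine List.sum_nonneg fun x hx => ?_
          obtain ⟨J, -, rfl⟩ := List.mem_map.mp hx
          positivity
        simp only [List.map_cons, List.sum_cons]
        linarith
    | none =>
      rw [hr] at h1 h2
      obtain ⟨f', k', l, h3, h4, h5⟩ := ih
        ⟨t.flops + f, J.card :: t.solves, t.nonnegSolutions + k⟩
      refine ⟨f + f', k + k', l, ?_, ?_, ?_⟩
      · rw [List.findSome?_cons, hr, ← add_assoc, ← add_assoc]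
        exact h1.bind h3
      · simp only [Option.isSome_none, Bool.false_eq_true, if_false] at h2
        rw [add_mul]
        omega
      · simp only [List.map_cons, List.sum_cons] at h5 ⊢
        linarith

/-! ### Cost of one pass through the loop -/

/-- Since `|J| ≤ m + 1`, forming `y` costs at most `(n+1)(2m+2)`. The reduction costs `(m+1)(2n+1) +
2(m+1)²`; by `m ≤ n` its first part fits into the per-pass allowance, and the second is the one-time
charge. -/
lemma stepSpec_inequalityStep {m n : ℕ} (hmn : m ≤ n) (e : Fin (n + 1) → ℝ) :
    StepSpec (inequalityStep m n e) (stepValue m n (matW m n) e)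
      ((n + 1) * (2 * n + 2 * m + 3)) (2 * (m + 1) ^ 2) := by
  intro J t
  have h1 := runs_solve (activeMatrix (matW m n) J) (fun i : J => -e i) t
  rw [Fintype.card_coe] at h1
  by_cases hr : (activeMatrix (matW m n) J).rank = J.card
  swap
  · rw [if_neg hr] at h1
    have hres : stepValue m n (matW m n) e J = none :=
      if_neg fun h => hr (by rw [h.1, Fintype.card_coe])
    rw [hres]
    exact ⟨0, 0, Runs.bind h1 (Runs.pure _ _), by simp⟩
  rw [if_pos hr] at h1
  rw [← Fintype.card_coe] at hr
  by_cases hx : 0 ≤ activeSolution (matW m n) e J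
  swap
  · have hres : stepValue m n (matW m n) e J = none := if_neg fun h => hx h.2.1
    rw [hres]
    exact ⟨0, 0, Runs.bind h1 (Runs.ite_neg hx (Runs.pure _ _)), by simp⟩
  have hcard : J.card ≤ m + 1 := by
    simpa using card_le_of_rank_activeMatrix_eq (V := matU m n) hr
  have h2 := runs_matVecOn (matW m n) J (v := activeMultiplier (matW m n) e J)
    (fun i hi => extendByZero_of_notMem _ hi) (t.addSolve J.card).addNonneg
  have h3 := runs_tabulate (fun i t =>
    runs_addOp t ((matW m n *ᵥ activeMultiplier (matW m n) e J) i) (e i))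
    ((t.addSolve J.card).addNonneg.addFlops ((n + 1) * (2 * J.card - 1)))
  have hc : (n + 1) * (2 * J.card - 1) + (n + 1) * 1 ≤ (n + 1) * (2 * m + 2) := by
    rw [← mul_add]
    exact Nat.mul_le_mul_left _ (by omega)
  by_cases hy : 0 ≤ matW m n *ᵥ activeMultiplier (matW m n) e J + e
  · have hres : stepValue m n (matW m n) e J
        = some (reduceValue m n (matW m n *ᵥ activeMultiplier (matW m n) e J + e)) :=
      if_pos ⟨hr, hx, hy⟩
    have h4 := runs_reduceDegree m n (matW m n *ᵥ activeMultiplier (matW m n) e J + e)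
      (((t.addSolve J.card).addNonneg.addFlops ((n + 1) * (2 * J.card - 1))).addFlops
        ((n + 1) * 1))
    rw [hres]
    refine ⟨(n + 1) * (2 * J.card - 1) + (n + 1) * 1 + (m + 1) * (2 * n + 2 * m + 3), 1, ?_, ?_⟩
    · have h : Runs (inequalityStep m n e J) t _ _ := Runs.bind h1 (Runs.ite_pos hx
        (Runs.bind (runs_recordNonneg _) (Runs.bind h2 (Runs.bind h3 (Runs.ite_pos hy
          (Runs.bind h4 (Runs.pure _ _)))))))
      simp only [Tally.addFlops_addFlops] at h
      exact h
    · simp only [Option.isSome_some, if_true]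
      nlinarith
  · have hres : stepValue m n (matW m n) e J = none := if_neg fun h => hy h.2.2
    rw [hres]
    refine ⟨(n + 1) * (2 * J.card - 1) + (n + 1) * 1, 1, ?_, ?_⟩
    · have h : Runs (inequalityStep m n e J) t _ _ := Runs.bind h1 (Runs.ite_pos hx
        (Runs.bind (runs_recordNonneg _) (Runs.bind h2 (Runs.bind h3 (Runs.ite_neg hy
          (Runs.pure _ _))))))
      simp only [Tally.addFlops_addFlops] at h
      exact h
    · simp only [Option.isSome_none, Bool.false_eq_true, if_false]
      nlinarith

/-- The matrix `W^{m,n}` with `1/2` subtracted from every entry. -/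
def centeredW (m n : ℕ) : Matrix (Fin (n + 1)) (Fin (n + 1)) ℝ := fun i j => matW m n i j - 1 / 2

/-- The all-ones column of `U` contributes exactly `½` to each entry of `W`; what remains is the
Gram matrix of the other `m` columns. -/
lemma centeredW_eq (m n : ℕ) : centeredW m n = (1 / 2 : ℝ) •
    ((matU m n).submatrix id Fin.succ * ((matU m n).submatrix id Fin.succ)ᵀ) := by
  ext i j
  simp only [centeredW, matW, Matrix.smul_apply, mul_apply, Fin.sum_univ_succ, transpose_apply,
    matU_zero, submatrix_apply, smul_eq_mul, id]
  ring

lemma centeredW_mulVec (m n : ℕ) (μ : Fin (n + 1) → ℝ) (i : Fin (n + 1)) :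
    (centeredW m n *ᵥ μ) i = (matW m n *ᵥ μ) i - (∑ j, μ j) / 2 := by
  simp only [mulVec, dotProduct, centeredW, sub_mul, Finset.sum_sub_distrib, ← Finset.mul_sum]
  ring

lemma stepSpec_equalityStep {m n : ℕ} (hmn : m ≤ n) (e : Fin (n + 1) → ℝ) :
    StepSpec (equalityStep m n e) (stepValue m n (centeredW m n) e)
      (2 * (n + 1) * (n + m + 2) + n) (2 * (m + 1) ^ 2) := by
  intro J t
  have h1 := runs_solve (activeMatrix (centeredW m n) J) (fun i : J => -e i) t
  rw [Fintype.card_coe] at h1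
  by_cases hr : (activeMatrix (centeredW m n) J).rank = J.card
  swap
  · rw [if_neg hr] at h1
    have hres : stepValue m n (centeredW m n) e J = none :=
      if_neg fun h => hr (by rw [h.1, Fintype.card_coe])
    rw [hres]
    exact ⟨0, 0, Runs.bind h1 (Runs.pure _ _), by simp⟩
  rw [if_pos hr] at h1
  rw [← Fintype.card_coe] at hr
  by_cases hx : 0 ≤ activeSolution (centeredW m n) e J
  swap
  · have hres : stepValue m n (centeredW m n) e J = none := if_neg fun h => hx h.2.1
    rw [hres]
    exact ⟨0, 0, Runs.bind h1 (Runs.ite_neg hx (Runs.pure _ _)), by simp⟩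
  have hcard : J.card ≤ m := by
    rw [centeredW_eq] at hr
    simpa using card_le_of_rank_activeMatrix_eq hr
  set μ := activeMultiplier (centeredW m n) e J with hμ
  have hν := runs_sumList (List.ofFn μ) (t.addSolve J.card).addNonneg
  rw [List.length_ofFn, List.sum_ofFn, Nat.add_sub_cancel] at hν
  have h2 := runs_matVecOn (matW m n) J (v := μ) (fun i hi => extendByZero_of_notMem _ hi)
    ((t.addSolve J.card).addNonneg.addFlops n)
  have h3 := fun t' => runs_tabulate (f := fun i => do
    let s ← subOp ((matW m n *ᵥ μ) i) ((∑ j, μ j) / 2)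
    addOp s (e i)) (a := 2) (fun i t => Runs.bind (runs_subOp t _ _) (runs_addOp _ _ _)) t'
  have hyv : (fun i => (matW m n *ᵥ μ) i - (∑ j, μ j) / 2 + e i) = centeredW m n *ᵥ μ + e := by
    ext i
    rw [Pi.add_apply, centeredW_mulVec]
  rw [hyv] at h3
  -- The bound `2|J| - 1 ≤ 2m` is one unit loose for `m > 0`, but with truncated subtraction it also
  -- covers `m = 0`.
  have hc : n + ((n + 1) * (2 * J.card - 1) + (1 + (n + 1) * 2)) ≤ (n + 1) * (2 * m + 3) := by
    have : (n + 1) * (2 * J.card - 1) ≤ (n + 1) * (2 * m) :=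
      Nat.mul_le_mul_left _ (by omega)
    nlinarith
  by_cases hy : 0 ≤ centeredW m n *ᵥ μ + e
  · have hres : stepValue m n (centeredW m n) e J
        = some (reduceValue m n (centeredW m n *ᵥ μ + e)) := if_pos ⟨hr, hx, hy⟩
    rw [hres]
    refine ⟨n + ((n + 1) * (2 * J.card - 1) + (1 + ((n + 1) * 2
      + (m + 1) * (2 * n + 2 * m + 3)))), 1, ?_, ?_⟩
    · have h : Runs (equalityStep m n e J) t _ _ := Runs.bind h1 (Runs.ite_pos hx
        (Runs.bind (runs_recordNonneg _) (Runs.bind hν (Runs.bind h2 (Runs.bind (runs_divOp _ _ _)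
          (Runs.bind (h3 _) (Runs.ite_pos hy
            (Runs.bind (runs_reduceDegree m n _ _) (Runs.pure _ _)))))))))
      simp only [Tally.addFlops_addFlops, add_assoc] at h
      exact h
    · simp only [Option.isSome_some, if_true]
      nlinarith
  · have hres : stepValue m n (centeredW m n) e J = none := if_neg fun h => hy h.2.2
    rw [hres]
    refine ⟨n + ((n + 1) * (2 * J.card - 1) + (1 + (n + 1) * 2)), 1, ?_, ?_⟩
    · have h : Runs (equalityStep m n e J) t _ _ := Runs.bind h1 (Runs.ite_pos hx
        (Runs.bind (runs_recordNonneg _) (Runs.bind hν (Runs.bind h2 (Runs.bind (runs_divOp _ _ _)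
          (Runs.bind (h3 _) (Runs.ite_neg hy (Runs.pure _ _))))))))
      simp only [Tally.addFlops_addFlops, add_assoc] at h
      exact h
    · simp only [Option.isSome_none, Bool.false_eq_true, if_false]
      nlinarith

/-! ### Total charge for the linear systems -/

/-- Inserting an element replaces `|J|` by `|J| + 1` in half of the terms, so the induction needs a
general cubic rather than the pure cube. -/
lemma sum_powerset_cubic {α : Type*} [DecidableEq α] (s : Finset α) (a b c d : ℝ) :
    ∑ J ∈ s.powerset, (a + b * J.card + c * (J.card : ℝ) ^ 2 + d * (J.card : ℝ) ^ 3)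
      = 2 ^ s.card * (a + b * s.card / 2 + c * (s.card * (s.card + 1)) / 4
        + d * (s.card ^ 2 * (s.card + 3)) / 8) := by
  induction s using Finset.induction_on generalizing a b c d with
  | empty => simp
  | insert x s hx ih =>
    rw [Finset.sum_powerset_insert hx, ih, Finset.card_insert_of_notMem hx]
    have h : ∀ J ∈ s.powerset, (a + b * ((insert x J).card : ℝ) + c * ((insert x J).card : ℝ) ^ 2
        + d * ((insert x J).card : ℝ) ^ 3)
        = (a + b + c + d) + (b + 2 * c + 3 * d) * J.card + (c + 3 * d) * (J.card : ℝ) ^ 2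
          + d * (J.card : ℝ) ^ 3 := fun J hJ => by
      rw [Finset.card_insert_of_notMem fun h => hx (Finset.mem_powerset.mp hJ h)]
      push_cast
      ring
    rw [Finset.sum_congr rfl h, ih]
    push_cast
    ring

lemma sum_solve_cost {n : ℕ} {Js : List (Finset (Fin (n + 1)))} (hnd : Js.Nodup)
    (hall : ∀ J, J ∈ Js) :
    (Js.map fun J => 2 * (J.card : ℝ) ^ 3 / 3).sum
      = (2 : ℝ) ^ ((n : ℤ) - 1) / 3 * ((n : ℝ) + 1) ^ 2 * (n + 4) := by
  rw [← List.sum_toFinset _ hnd, show Js.toFinset = Finset.univ by ext; simp [hall],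
    ← Finset.powerset_univ]
  have h := sum_powerset_cubic (Finset.univ : Finset (Fin (n + 1))) 0 0 0 (2 / 3)
  simp only [zero_mul, zero_add, Finset.card_univ, Fintype.card_fin, zero_div] at h
  rw [Finset.sum_congr rfl fun J _ => show 2 * (J.card : ℝ) ^ 3 / 3 = 2 / 3 * (J.card : ℝ) ^ 3 by
    ring, h, zpow_sub₀ two_ne_zero, zpow_natCast, pow_succ]
  push_cast
  ring

lemma StepSpec.algorithm {m n : ℕ} {β : Type} {step : (Fin (n + 1) → ℝ) →
    Finset (Fin (n + 1)) → Counted (Option β)} {res : Finset (Fin (n + 1)) → Option β} {c d : ℕ}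
    {a : Fin (m + 1) → ℝ} (h : StepSpec (step (elevation m n *ᵥ a)) res c d)
    {Js : List (Finset (Fin (n + 1)))} (hnd : Js.Nodup) (hall : ∀ J, J ∈ Js)
    {prog : Counted (Option β)}
    (hprog : prog = matVec (elevation m n) a >>= fun e => Js.findSomeM? (step e)) :
    prog.output = Js.findSome? res ∧ prog.operations ≤ (prog.nonnegSolutions : ℝ) * c
      + ((n : ℝ) + 1) * (2 * m + 1) + d
      + (2 : ℝ) ^ ((n : ℤ) - 1) / 3 * ((n : ℝ) + 1) ^ 2 * (n + 4) := by
  subst hprog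
  have h1 := runs_matVec (elevation m n) a ⟨0, [], 0⟩
  obtain ⟨f, k, l, h2, h3, h4⟩ := h.findSomeM? Js (Tally.addFlops ⟨0, [], 0⟩
    ((n + 1) * (2 * (m + 1) - 1)))
  have h5 : Counted.exec (matVec (elevation m n) a >>= fun e => Js.findSomeM? (step e))
    = _ := h1.bind h2
  rw [Counted.output, Counted.operations, Counted.nonnegSolutions, h5]
  refine ⟨rfl, ?_⟩
  rw [sum_solve_cost hnd hall] at h4
  simp only [Tally.addFlops, zero_add, List.map_nil, List.sum_nil] at h4 ⊢
  have h6 : (f : ℝ) ≤ k * c + d := by exact_mod_cast h3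
  have h7 : (((n + 1) * (2 * (m + 1) - 1) + f : ℕ) : ℝ) = ((n : ℝ) + 1) * (2 * m + 1) + f := by
    rw [show 2 * (m + 1) - 1 = 2 * m + 1 by omega]
    push_cast
    ring
  -- In `Counted.operations` the list of sizes is cast to `ℝ` as a whole, through the list monad;
  -- this moves the cast inside the summand.
  have h8 : (List.map (fun k : ℝ => 2 * k ^ 3 / 3) (l >>= fun a => pure (a : ℝ))).sum
      = (l.map fun k : ℕ => 2 * (k : ℝ) ^ 3 / 3).sum := by
    rw [bind_pure_comp, List.map_eq_map, List.map_map]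
    rfl
  rw [h7]
  refine (add_le_add_right (h8.le.trans h4) _).trans ?_
  linarith

/-! ### Correctness of the returned vector -/

lemma findSome?_eq_of_forall {α β : Type*} {f : α → Option β} {l : List α} {v : β}
    (h : ∀ a ∈ l, ∀ b, f a = some b → b = v) (hex : ∃ a ∈ l, (f a).isSome) :
    l.findSome? f = some v := by
  obtain ⟨b, hb⟩ := Option.isSome_iff_exists.mp (List.findSome?_isSome_iff.mpr hex)
  obtain ⟨a, ha, hab⟩ := List.exists_of_findSome?_eq_some hb
  rw [hb, h a ha b hab]

lemma findSome?_stepValue {m n : ℕ} {W : Matrix (Fin (n + 1)) (Fin (n + 1)) ℝ}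
    {e : Fin (n + 1) → ℝ} {Js : List (Finset (Fin (n + 1)))} (hall : ∀ J, J ∈ Js)
    {v : Fin (m + 1) → ℝ} (hex : ∃ J, Accepted W e J)
    (h : ∀ J, Accepted W e J → reduceValue m n (W *ᵥ activeMultiplier W e J + e) = v) :
    Js.findSome? (stepValue m n W e) = some v := by
  obtain ⟨J, hJ⟩ := hex
  refine findSome?_eq_of_forall (fun J _ b hb => ?_) ⟨J, hall J, by simp [stepValue, hJ]⟩
  unfold stepValue at hb
  split_ifs at hb with hacc
  rw [← h J hacc]
  exact (Option.some.inj hb).symm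

lemma reduceValue_matU {m n : ℕ} (hmn : m ≤ n) (q : PolyLE m) :
    reduceValue m n (matU m n *ᵥ legendreCoord q) = bernsteinCoeff q := by
  rw [reduceValue, diagonal_mulVec_matU hmn, matU_mulVec_legendreCoord]

/-- An accepted active set of the inequality-constrained algorithm yields the best
approximation. -/
lemma isBestApprox_of_accepted {m n : ℕ} (hmn : m ≤ n) (p : PolyLE m)
    {J : Finset (Fin (n + 1))} (hJ : Accepted (matW m n) (elevation m n *ᵥ bernsteinCoeff p) J) :
    ∃ q : PolyLE m, IsBestApprox (posPoly m n) p q ∧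
      (∀ r, IsBestApprox (posPoly m n) p r → r = q) ∧
      reduceValue m n (matW m n *ᵥ activeMultiplier (matW m n)
        (elevation m n *ᵥ bernsteinCoeff p) J + elevation m n *ᵥ bernsteinCoeff p)
        = bernsteinCoeff q := by
  obtain ⟨h1, h2, h3⟩ := hJ
  have hcomp := activeMultiplier_complementary (e := elevation m n *ᵥ bernsteinCoeff p) h1
  have hμ : 0 ≤ activeMultiplier (matW m n) (elevation m n *ᵥ bernsteinCoeff p) J :=
    extendByZero_nonneg h2
  set μ := activeMultiplier (matW m n) (elevation m n *ᵥ bernsteinCoeff p) J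
  set z := (1 / 2 : ℝ) • ((matU m n)ᵀ *ᵥ μ) with hz
  let q : PolyLE m := ofLegendre (z + legendreCoord p)
  have hq : legendreCoord q = z + legendreCoord p := legendreCoord_ofLegendre _
  -- The vector `y` tested by the algorithm consists of the degree-`n` Bernstein coefficients of
  -- `q`, so acceptance means feasibility.
  have hy : matW m n *ᵥ μ + elevation m n *ᵥ bernsteinCoeff p = matU m n *ᵥ legendreCoord q := by
    rw [hq, mulVec_add, elevation_mulVec_bernsteinCoeff hmn, hz, mulVec_smul, mulVec_mulVec, matW,
      smul_mulVec]
  have hmem : q ∈ posPoly m n := by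
    rw [posPoly, Set.mem_ofPred_eq, elevation_mulVec_bernsteinCoeff hmn, ← hy]
    exact h3
  obtain ⟨h4, h5⟩ := existsUnique_isBestApprox (p := p) hmem fun r hr => by
    have hw : 0 ≤ matU m n *ᵥ (legendreCoord r - legendreCoord p)
        + elevation m n *ᵥ bernsteinCoeff p := by
      rw [elevation_mulVec_bernsteinCoeff hmn, mulVec_sub, sub_add_cancel,
        ← elevation_mulVec_bernsteinCoeff hmn]
      exact hr
    have := kkt_sufficient hμ hcomp hw
    rw [hq, add_sub_cancel_right, show legendreCoord r - (z + legendreCoord p)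
      = legendreCoord r - legendreCoord p - z by abel]
    exact this
  exact ⟨q, h4, h5, by rw [hy, reduceValue_matU hmn]⟩

/-- An accepted active set of the algorithm with mass preservation yields the best
approximation. -/
lemma isBestApprox_mass_of_accepted {m n : ℕ} (hmn : m ≤ n) (p : PolyLE m)
    {J : Finset (Fin (n + 1))}
    (hJ : Accepted (centeredW m n) (elevation m n *ᵥ bernsteinCoeff p) J) :
    ∃ q : PolyLE m,
      IsBestApprox {q | q ∈ posPoly m n ∧ mass (p : ℝ[X]) = mass (q : ℝ[X])} p q ∧
      (∀ r, IsBestApprox {q | q ∈ posPoly m n ∧ mass (p : ℝ[X]) = mass (q : ℝ[X])} p r → r = q) ∧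
      reduceValue m n (centeredW m n *ᵥ activeMultiplier (centeredW m n)
        (elevation m n *ᵥ bernsteinCoeff p) J + elevation m n *ᵥ bernsteinCoeff p)
        = bernsteinCoeff q := by
  obtain ⟨h1, h2, h3⟩ := hJ
  have hcomp := activeMultiplier_complementary (e := elevation m n *ᵥ bernsteinCoeff p) h1
  have hμ : 0 ≤ activeMultiplier (centeredW m n) (elevation m n *ᵥ bernsteinCoeff p) J :=
    extendByZero_nonneg h2
  set μ := activeMultiplier (centeredW m n) (elevation m n *ᵥ bernsteinCoeff p) J
  set V := (matU m n).submatrix id (Fin.succ : Fin m → Fin (m + 1)) with hV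
  -- Equal mass means that the coordinate difference to `p` starts with `0`, so admissible
  -- differences are parametrized by `Fin m → ℝ` with constraint matrix `V`.
  have hcons : ∀ w : Fin m → ℝ, matU m n *ᵥ (Fin.cons 0 w : Fin (m + 1) → ℝ) = V *ᵥ w := fun w => by
    ext i
    simp [mulVec, dotProduct, Fin.sum_univ_succ, hV]
  have hdot : ∀ w : Fin m → ℝ, (Fin.cons 0 w : Fin (m + 1) → ℝ) ⬝ᵥ (Fin.cons 0 w) = w ⬝ᵥ w :=
    fun w => by simp [dotProduct, Fin.sum_univ_succ]
  have hsub : ∀ w w' : Fin m → ℝ, (Fin.cons 0 w - Fin.cons 0 w' : Fin (m + 1) → ℝ)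
      = Fin.cons 0 (w - w') := fun w w' => by
    ext i
    refine Fin.cases ?_ (fun i => ?_) i <;> simp
  set z := (1 / 2 : ℝ) • (Vᵀ *ᵥ μ) with hz
  let q : PolyLE m := ofLegendre (Fin.cons 0 z + legendreCoord p)
  have hq : legendreCoord q = Fin.cons 0 z + legendreCoord p := legendreCoord_ofLegendre _
  have hy : centeredW m n *ᵥ μ + elevation m n *ᵥ bernsteinCoeff p
      = matU m n *ᵥ legendreCoord q := by
    rw [hq, mulVec_add, hcons, elevation_mulVec_bernsteinCoeff hmn, hz, mulVec_smul,
      mulVec_mulVec, centeredW_eq, smul_mulVec]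
  have hmem : q ∈ {q : PolyLE m | q ∈ posPoly m n ∧ mass (p : ℝ[X]) = mass (q : ℝ[X])} := by
    refine ⟨?_, ?_⟩
    · rw [posPoly, Set.mem_ofPred_eq, elevation_mulVec_bernsteinCoeff hmn, ← hy]
      exact h3
    · rw [mass_eq_legendreCoord_zero, mass_eq_legendreCoord_zero, hq]
      simp
  rw [centeredW_eq] at hcomp
  obtain ⟨h4, h5⟩ := existsUnique_isBestApprox (p := p) hmem fun r hr => by
    let w : Fin m → ℝ := fun i => (legendreCoord r - legendreCoord p) i.succ
    have hr0 : legendreCoord r - legendreCoord p = Fin.cons 0 w := by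
      ext i
      refine Fin.cases ?_ (fun i => ?_) i
      · have := hr.2
        rw [mass_eq_legendreCoord_zero, mass_eq_legendreCoord_zero] at this
        simp [this]
      · simp [w]
    have hw : 0 ≤ V *ᵥ w + elevation m n *ᵥ bernsteinCoeff p := by
      rw [← hcons, ← hr0, elevation_mulVec_bernsteinCoeff hmn, mulVec_sub, sub_add_cancel,
        ← elevation_mulVec_bernsteinCoeff hmn]
      exact hr.1
    have := kkt_sufficient hμ hcomp hw
    rw [hq, add_sub_cancel_right, show legendreCoord r - (Fin.cons 0 z + legendreCoord p)
      = legendreCoord r - legendreCoord p - Fin.cons 0 z by abel, hr0, hsub, hdot, hdot, hdot]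
    exact this
  exact ⟨q, h4, h5, by rw [hy, reduceValue_matU hmn]⟩

/-- The zero polynomial is feasible; its displacement from `p` is `-legendreCoord p`. -/
lemma exists_accepted_matW {m n : ℕ} (hmn : m ≤ n) (p : PolyLE m) :
    ∃ J, Accepted (matW m n) (elevation m n *ᵥ bernsteinCoeff p) J :=
  exists_accepted (matU m n) _ ⟨-legendreCoord p, by
    rw [elevation_mulVec_bernsteinCoeff hmn, mulVec_neg, neg_add_cancel]⟩

/-- The constant polynomial with the mass of `p` is feasible, which is where nonnegative mass
enters. -/
lemma exists_accepted_centeredW {m n : ℕ} (hmn : m ≤ n) {p : PolyLE m}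
    (hp : 0 ≤ mass (p : ℝ[X])) :
    ∃ J, Accepted (centeredW m n) (elevation m n *ᵥ bernsteinCoeff p) J := by
  rw [centeredW_eq]
  refine exists_accepted _ _ ⟨fun i => -legendreCoord p i.succ, fun i => ?_⟩
  rw [mass_eq_legendreCoord_zero] at hp
  rw [elevation_mulVec_bernsteinCoeff hmn]
  simpa [mulVec, dotProduct, Fin.sum_univ_succ, matU_zero] using hp

end BernsteinKKT

end

theorem mainTheorem1 (m n : ℕ) (hmn : m ≤ n)
    (Js : List (Finset (Fin (n + 1)))) (hJs_nodup : Js.Nodup) (hJs_all : ∀ J, J ∈ Js)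
    (p : PolyLE m) :
    ((∃! q : PolyLE m, IsBestApprox (posPoly m n) p q) ∧
      (∀ q : PolyLE m, IsBestApprox (posPoly m n) p q →
        (inequalityAlgorithm m n Js (bernsteinCoeff p)).output = some (bernsteinCoeff q)) ∧
      (inequalityAlgorithm m n Js (bernsteinCoeff p)).operations ≤
        ((inequalityAlgorithm m n Js (bernsteinCoeff p)).nonnegSolutions : ℝ) *
            (((n : ℝ) + 1) * (2 * n + 2 * m + 3)) +
          ((n : ℝ) + 1) * (2 * m + 1) + 2 * ((m : ℝ) + 1) ^ 2 +
          (2 : ℝ) ^ ((n : ℤ) - 1) / 3 * ((n : ℝ) + 1) ^ 2 * (n + 4)) ∧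
    (0 ≤ mass (p : ℝ[X]) →
      (∃! q : PolyLE m,
        IsBestApprox {q | q ∈ posPoly m n ∧ mass (p : ℝ[X]) = mass (q : ℝ[X])} p q) ∧
      (∀ q : PolyLE m,
        IsBestApprox {q | q ∈ posPoly m n ∧ mass (p : ℝ[X]) = mass (q : ℝ[X])} p q →
        (equalityAlgorithm m n Js (bernsteinCoeff p)).output = some (bernsteinCoeff q)) ∧
      (equalityAlgorithm m n Js (bernsteinCoeff p)).operations ≤
        ((equalityAlgorithm m n Js (bernsteinCoeff p)).nonnegSolutions : ℝ) *
            (2 * ((n : ℝ) + 1) * (n + m + 2) + n) +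
          ((n : ℝ) + 1) * (2 * m + 1) + 2 * ((m : ℝ) + 1) ^ 2 +
          (2 : ℝ) ^ ((n : ℤ) - 1) / 3 * ((n : ℝ) + 1) ^ 2 * (n + 4)) := by
  constructor
  · obtain ⟨J, hJ⟩ := exists_accepted_matW hmn p
    obtain ⟨q, h1, h2, -⟩ := isBestApprox_of_accepted hmn p hJ
    obtain ⟨h3, h4⟩ := (stepSpec_inequalityStep hmn _).algorithm hJs_nodup hJs_all
      (prog := inequalityAlgorithm m n Js (bernsteinCoeff p)) rfl
    refine ⟨⟨q, h1, h2⟩, fun r hr => ?_, by push_cast at h4; exact h4⟩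
    rw [h3]
    refine findSome?_stepValue hJs_all ⟨J, hJ⟩ fun J' hJ' => ?_
    -- The set reached first may differ from `J`; uniqueness identifies its minimizer with `r`.
    obtain ⟨q', -, h5, h6⟩ := isBestApprox_of_accepted hmn p hJ'
    rw [h6, h5 r hr]
  · intro hp
    obtain ⟨J, hJ⟩ := exists_accepted_centeredW hmn hp
    obtain ⟨q, h1, h2, -⟩ := isBestApprox_mass_of_accepted hmn p hJ
    obtain ⟨h3, h4⟩ := (stepSpec_equalityStep hmn _).algorithm hJs_nodup hJs_all
      (prog := equalityAlgorithm m n Js (bernsteinCoeff p)) rfl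
    refine ⟨⟨q, h1, h2⟩, fun r hr => ?_, by push_cast at h4; exact h4⟩
    rw [h3]
    refine findSome?_stepValue hJs_all ⟨J, hJ⟩ fun J' hJ' => ?_
    obtain ⟨q', -, h5, h6⟩ := isBestApprox_mass_of_accepted hmn p hJ'
    rw [h6, h5 r hr]
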